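/- All graphs are finite and simple. A graph $G=(V,E)$ is a *$4$-Steiner power* if there is a finite tree $T$ with $V\subseteq V(T)$ such that any two distinct $u,v\in V$ are adjacent in $G$ if and only if $\mathrm{dist}_T(u,v)\le 4$; such a $T$ is a *$4$-Steiner root* of $G$, and the nodes in $V(T)\setminus V$ are its *Steiner nodes*. For $X\subseteq V$ nonempty, $T\langle X\rangle$ is the smallest subtree of $T$ containing $X$, and $\mathcal C(T\langle X\rangle)$ is its center, the set of its nodes of minimum eccentricity. A *clique-intersection* of $G$ is the intersection of a nonempty family of inclusion-wise maximal cliques of $G$. For a clique-intersection $X$, a vertex $v\in X$ is *$X$-free* if neither of the following holds: (i) there is a clique-intersection $X'\subsetneq X$ with $v\in X'$ and $|X'|\ge 2$; (ii) there are clique-intersections $X_1,X_2$ with $X\subsetneq X_1$ and $X\cap X_2=\{v\}\subsetneq X_1\cap X_2$. **Theorem.** Let $G=(V,E)$ be a connected $4$-Steiner power with at least two vertices. Then there is a $4$-Steiner root $T$ of $G$ such that, for every nonempty clique-intersection $X$ of $G$: 1. every $X$-free vertex is a leaf of $T\langle X\rangle$ whose eccentricity in $T\langle X\rangle$ is the maximum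 possible, $\mathrm{diam}(T\langle X\rangle)$; 2. there is a node $c\in\mathcal C(T\langle X\rangle)$ such that $\mathrm{dist}_T(v,c)=\mathrm{dist}_T(v,\mathcal C(T\langle X\rangle))$ for all $X$-free vertices $v$ except at most one; 3. for every $X$-free vertex $v$, all internal nodes of the path of $T$ between $v$ and $\mathcal C(T\langle X\rangle)$ (from $v$ to its closest center node) are Steiner nodes of degree two in $T$; 4. if $X$ is a maximal clique and has an $X$-free vertex, then $\mathrm{diam}(T\langle X\rangle)=4$. -/

import Mathlib

universe u

namespace SteinerPower

/-- The `k`-th power of a graph `T`: same nodes, and two nodes are adjacent when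
`0 < dist_T(u, v) ≤ k`. (The distance of nodes in different components is `0` in Mathlib, so such
nodes are not adjacent either.) -/
def power {W : Type*} (T : SimpleGraph W) (k : ℕ) : SimpleGraph W where
  Adj a b := 0 < T.dist a b ∧ T.dist a b ≤ k
  symm := ⟨fun a b h => by rwa [T.dist_comm]⟩
  loopless := ⟨fun a h => by simp at h⟩

/-- `G` is a `k`-Steiner power: there is a finite tree `T` such that `G` is (up to the
identification `f` of its vertices with nodes of `T`) an induced subgraph of the `k`-th power
of `T`. -/
def IsSteinerPower (k : ℕ) {V : Type u} (G : SimpleGraph V) : Prop :=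
  ∃ (W : Type u) (_ : Finite W) (T : SimpleGraph W), T.IsTree ∧ Nonempty (G ↪g power T k)

/-- The clique-intersections of `G`: the intersections of nonempty families of (inclusion-wise)
maximal cliques of `G`. -/
def cliqueIntersections {V : Type*} (G : SimpleGraph V) : Set (Set V) :=
  {X | ∃ F : Set (Set V), F.Nonempty ∧ (∀ K ∈ F, Maximal G.IsClique K) ∧ X = ⋂₀ F}

/-- `v` is internally `X`-constrained: it lies in a clique-intersection with at least two elements
that is strictly contained in `X`. -/
def InternallyConstrained {V : Type*} (G : SimpleGraph V) (X : Set V) (v : V) : Prop :=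
  ∃ X' ∈ cliqueIntersections G, X' ⊂ X ∧ v ∈ X' ∧ 2 ≤ X'.encard

/-- `v` is `(X, X₁, X₂)`-sandwiched for some clique-intersections `X₁`, `X₂`. -/
def Sandwiched {V : Type*} (G : SimpleGraph V) (X : Set V) (v : V) : Prop :=
  ∃ X₁ ∈ cliqueIntersections G, ∃ X₂ ∈ cliqueIntersections G,
    X ⊂ X₁ ∧ X ∩ X₂ = {v} ∧ {v} ⊂ X₁ ∩ X₂

/-- `v` is an `X`-free vertex: a vertex of `X` that is not `X`-constrained. -/
def IsFree {V : Type*} (G : SimpleGraph V) (X : Set V) (v : V) : Prop :=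
  v ∈ X ∧ ¬ (InternallyConstrained G X v ∨ Sandwiched G X v)

/-- The node set of the smallest subtree of the tree `T` that contains the nodes in `A`: the
intersection of (the node sets of) all connected induced subgraphs of `T` containing `A`. -/
def subtreeNodes {W : Type*} (T : SimpleGraph W) (A : Set W) : Set W :=
  ⋂₀ {S | A ⊆ S ∧ (T.induce S).Connected}

/-- `T⟨A⟩`, the smallest subtree of the tree `T` that contains the nodes in `A`. -/
abbrev subtree {W : Type*} (T : SimpleGraph W) (A : Set W) : SimpleGraph (subtreeNodes T A) :=
  T.induce (subtreeNodes T A)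

/-- The center of `T⟨A⟩` (its nodes of minimum eccentricity), as a set of nodes of `T`. -/
def subtreeCenter {W : Type*} (T : SimpleGraph W) (A : Set W) : Set W :=
  Subtype.val '' (subtree T A).center

/-- `dist_T(w, C)`, the distance from a node to a nonempty set of nodes. -/
noncomputable def distToSet {W : Type*} (T : SimpleGraph W) (w : W) (C : Set W) : ℕ :=
  sInf (T.dist w '' C)

/-- The `k`-Steiner root `T` of `G`, in which the real node representing a vertex `v` of `G` is
`f v`, has the four properties of a well-structured root. Nodes outside the range of `f` are the
Steiner nodes. -/
structure WellStructured {k : ℕ} {V W : Type*} (G : SimpleGraph V) (T : SimpleGraph W)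
    (f : G ↪g power T k) : Prop where
  /-- `X`-free vertices are leaves of `T⟨X⟩`, with maximum eccentricity `diam(T⟨X⟩)`. -/
  leaf : ∀ X ∈ cliqueIntersections G, X.Nonempty → ∀ v, IsFree G X v →
    ∃ h : f v ∈ subtreeNodes T (f '' X),
      ((subtree T (f '' X)).neighborSet ⟨f v, h⟩).encard = 1 ∧
      (subtree T (f '' X)).eccent ⟨f v, h⟩ = (subtree T (f '' X)).ediam
  /-- Some center node `c` of `T⟨X⟩` is a closest center node for all `X`-free vertices, except
  for at most one of them. -/
  grouped : ∀ X ∈ cliqueIntersections G, X.Nonempty → ∃ c ∈ subtreeCenter T (f '' X),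
    {v | IsFree G X v ∧
      T.dist (f v) c ≠ distToSet T (f v) (subtreeCenter T (f '' X))}.Subsingleton
  /-- On a path of `T` between the center of `T⟨X⟩` and an `X`-free vertex (a path that meets the
  center only at its first node) every internal node is a Steiner node whose degree in `T` is
  two. -/
  internal : ∀ X ∈ cliqueIntersections G, X.Nonempty → ∀ v, IsFree G X v →
    ∀ c ∈ subtreeCenter T (f '' X), ∀ p : T.Walk c (f v), p.IsPath →
      (∀ w ∈ p.support, w ∈ subtreeCenter T (f '' X) → w = c) →
      ∀ w ∈ p.support, w ≠ c → w ≠ f v → w ∉ Set.range f ∧ (T.neighborSet w).encard = 2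
  /-- If a maximal clique `K` has a `K`-free vertex, then `T⟨K⟩` has diameter exactly four. -/
  diam_eq : ∀ K, Maximal G.IsClique K → (∃ v, IsFree G K v) →
    (subtree T (f '' K)).ediam = 4

end SteinerPower

/-! The proof is extremal. Fix any vertex `r` and choose a root maximising, lexicographically, the
number of vertices at tree distance at least two from all other vertices, then the sum of the
distances to `r`, then the sum of all distances; prune it to the subtree spanned by the vertices.
Everything follows from the fact that the parts of such a root cannot be pushed further apart.

If `v` is `X`-free, its neighbours in the maximal cliques containing `X` are not adjacent to its
other neighbours (`not_adj_of_isFree`), and in a 4-Steiner power this local separation extends to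
the whole graph: `v` cuts off a set `H` containing the hull of `X` minus `v` (`exists_isSplit`). The
part of the tree representing `H` may therefore be detached and tied to `v` by a path of length `t`
starting at a node `z`. If `dist(v, z) ≤ t` and each hull vertex is within `4 - t` of `z`, no
distance shrinks and adjacency is preserved. By optimality every distance is unchanged, so `dist(x,
y) = dist(x, v) + t + dist(z, y)` for `x ∉ H` and `y ∈ H` (`IsOptimal.dist_eq`).

With `z` the middle of a longest path of `T⟨X⟩`, this rigidity makes `v` a leaf of maximum
eccentricity and forbids branches or vertices of `G` between `v` and the center. With `z = v` and `t
= 1` it gives diameter four for maximal cliques.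

Grouping is delicate only for diameter three, with center `{a, b}`. If two free vertices hung at `a`
and two at `b`, one could be moved across the edge. The first two components of the score ensure
that the move in a suitable direction is an improvement (`HasMiddleEdge.false_of_two_of_two`). -/

namespace SteinerPower

/-! ### Distances, separation and medians in trees. -/

section Tree

variable {W : Type*} {T : SimpleGraph W}

lemma dist_swap (T : SimpleGraph W) (x y : W) : T.dist x y = T.dist y x :=
  SimpleGraph.dist_comm

/-- A function that grows by at most one along the edges is a lower bound for the distance. -/
lemma le_add_dist_of_forall_adj (hT : T.Connected) (φ : W → ℕ)
    (hφ : ∀ x y, T.Adj x y → φ y ≤ φ x + 1) (a b : W) : φ b ≤ φ a + T.dist a b := by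
  obtain ⟨p, hp⟩ := hT.exists_walk_length_eq_dist a b
  rw [← hp]
  clear hp
  induction p with
  | nil => simp
  | cons h p ih =>
    have := hφ _ _ h
    simp only [SimpleGraph.Walk.length_cons]
    omega

/-- In a tree, a node `m` on the path between `y` and `w` separates each node from `y` or `w`. -/
lemma dist_eq_or_dist_eq (hT : T.IsTree) {y m w : W}
    (h : T.dist y w = T.dist y m + T.dist m w) (x : W) :
    T.dist x y = T.dist x m + T.dist m y ∨ T.dist x w = T.dist x m + T.dist m w := by
  classical
  obtain ⟨p, hp⟩ := hT.connected.exists_walk_length_eq_dist x y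
  obtain ⟨q, hq⟩ := hT.connected.exists_walk_length_eq_dist x w
  have key : ∀ {z : W} (r : T.Walk x z), r.length = T.dist x z → m ∈ r.support →
      T.dist x z = T.dist x m + T.dist m z := by
    intro z r hr hm
    have h1 := T.dist_le (r.takeUntil m hm)
    have h2 := T.dist_le (r.dropUntil m hm)
    have h3 := congrArg SimpleGraph.Walk.length (r.take_spec hm)
    rw [SimpleGraph.Walk.length_append] at h3
    have := hT.connected.dist_triangle (u := x) (v := m) (w := z)
    omega
  by_cases hmp : m ∈ p.support
  · exact Or.inl (key p hp hmp)
  by_cases hmq : m ∈ q.support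
  · exact Or.inr (key q hq hmq)
  exfalso
  obtain ⟨p1, hp1⟩ := hT.connected.exists_walk_length_eq_dist y m
  obtain ⟨p2, hp2⟩ := hT.connected.exists_walk_length_eq_dist m w
  have hpath : (p1.append p2).IsPath := by
    apply SimpleGraph.Walk.isPath_of_length_eq_dist
    rw [SimpleGraph.Walk.length_append]
    omega
  -- The walk from `y` through `x` to `w` avoids `m`, yet shortcutting it gives the unique path from
  -- `y` to `w`, on which `m` lies.
  have huniq := (hT.existsUnique_path y w).unique hpath
    (p.reverse.append q).bypass_isPath
  have hm : m ∈ (p1.append p2).support := by simp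
  rw [huniq] at hm
  have := SimpleGraph.Walk.support_bypass_subset_support _ hm
  simp [SimpleGraph.Walk.mem_support_append_iff, hmp, hmq] at this

/-- In a connected graph, the first step of a shortest path. -/
lemma exists_adj_dist_eq (hT : T.Connected) {x y : W} (h : x ≠ y) :
    ∃ m, T.Adj x m ∧ T.dist x y = T.dist m y + 1 := by
  obtain ⟨p, hp⟩ := hT.exists_walk_length_eq_dist x y
  cases p with
  | nil => exact absurd rfl h
  | @cons _ m _ hadj p =>
    refine ⟨m, hadj, ?_⟩
    have h1 := T.dist_le p
    have h2 := hT.dist_triangle (u := x) (v := m) (w := y)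
    have h3 := SimpleGraph.dist_eq_one_iff_adj.2 hadj
    rw [SimpleGraph.Walk.length_cons] at hp
    omega

/-- In a connected graph, the node at distance `k` from the start of a shortest path. -/
lemma exists_dist_eq_of_le (hT : T.Connected) (x y : W) (k : ℕ) (hk : k ≤ T.dist x y) :
    ∃ m, T.dist x m = k ∧ T.dist x y = k + T.dist m y := by
  induction k with
  | zero => exact ⟨x, by simp, by simp⟩
  | succ k ih =>
    obtain ⟨m, hm, hmy⟩ := ih (by omega)
    have hne : m ≠ y := by
      rintro rfl
      omega
    obtain ⟨m', hadj, hm'⟩ := exists_adj_dist_eq hT hne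
    have h1 := hT.dist_triangle (u := x) (v := m') (w := y)
    have h2 := hT.dist_triangle (u := x) (v := m) (w := m')
    have h3 := SimpleGraph.dist_eq_one_iff_adj.2 hadj
    exact ⟨m', by omega, by omega⟩

/-- Any three nodes of a tree have a median. -/
lemma exists_median (hT : T.IsTree) (x y z : W) :
    ∃ m, T.dist x y = T.dist x m + T.dist m y ∧ T.dist z x = T.dist z m + T.dist m x ∧
      T.dist z y = T.dist z m + T.dist m y := by
  classical
  -- The median is the node nearest to `z` on the path between `x` and `y`.
  have hex : ∃ n m, T.dist x y = T.dist x m + T.dist m y ∧ T.dist z m = n := ⟨_, x, by simp, rfl⟩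
  obtain ⟨m, hm, hmn⟩ := Nat.find_spec hex
  have hmin : ∀ m', T.dist x y = T.dist x m' + T.dist m' y → T.dist z m ≤ T.dist z m' := by
    intro m' hm'
    rw [hmn]
    exact Nat.find_min' hex ⟨m', hm', rfl⟩
  have main : ∀ x y : W, T.dist x y = T.dist x m + T.dist m y →
      (∀ m', T.dist x y = T.dist x m' + T.dist m' y → T.dist z m ≤ T.dist z m') →
      T.dist z y = T.dist z m + T.dist m y := by
    intro x y hm hmin
    by_cases hne : m = y
    · subst hne
      simp
    obtain ⟨m', hadj, hm'⟩ := exists_adj_dist_eq hT.connected hne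
    have h1 := SimpleGraph.dist_eq_one_iff_adj.2 hadj
    have h2 := hT.connected.dist_triangle (u := x) (v := m) (w := m')
    have h3 := hT.connected.dist_triangle (u := x) (v := m') (w := y)
    have h4 := hmin m' (by omega)
    have h5 := hT.dist_eq_dist_add_one_of_adj z hadj
    -- By minimality `m'` is one step further from `z` than `m`, so `m` separates `y` from `z` or
    -- from `m'`; the latter fails because `m'` is nearer to `y`.
    rcases dist_eq_or_dist_eq hT (y := z) (m := m) (w := m') (by omega) y with h | h
    · rw [dist_swap T z y, h, dist_swap T z m, dist_swap T m y]
      omega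
    · rw [dist_swap T y m', dist_swap T y m] at h
      omega
  refine ⟨m, hm, ?_, main x y hm hmin⟩
  refine main y x (by rw [dist_swap T y x, dist_swap T y m, dist_swap T m x]; omega) ?_
  intro m' h
  refine hmin m' ?_
  rw [dist_swap T x y, h, dist_swap T y m', dist_swap T m' x]
  omega

/-- Two neighbours of `v` on shortest paths from `v` to `y` coincide. -/
lemma eq_of_adj_of_dist_eq (hT : T.IsTree) {v a b y : W} (ha : T.Adj v a) (hb : T.Adj v b)
    (hya : T.dist v y = T.dist a y + 1) (hyb : T.dist v y = T.dist b y + 1) : a = b := by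
  have h1 := SimpleGraph.dist_eq_one_iff_adj.2 ha
  have h2 := SimpleGraph.dist_eq_one_iff_adj.2 hb
  rcases dist_eq_or_dist_eq hT (y := v) (m := a) (w := y) (by omega) b with h | h
  · rw [dist_swap T b v, dist_swap T a v] at h
    exact ((hT.connected.dist_eq_zero_iff).1 (by omega)).symm
  · exact ((hT.connected.dist_eq_zero_iff).1 (by omega)).symm

/-- Nodes that are within distance one of both ends of an edge are ends of the edge. -/
lemma eq_or_eq_of_dist_le_one (hT : T.IsTree) {a b w : W} (hab : T.Adj a b)
    (ha : T.dist w a ≤ 1) (hb : T.dist w b ≤ 1) : w = a ∨ w = b := by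
  have := hT.dist_ne_of_adj w hab
  have h1 := hT.connected.dist_eq_zero_iff (u := w) (v := a)
  have h2 := hT.connected.dist_eq_zero_iff (u := w) (v := b)
  by_cases h : T.dist w a = 0
  · exact Or.inl (h1.1 h)
  · exact Or.inr (h2.1 (by omega))

/-! ### Smallest subtrees, their eccentricities and centers. -/

/-- A set of nodes that contains the paths between its members. -/
def PathClosed (T : SimpleGraph W) (S : Set W) : Prop :=
  ∀ x ∈ S, ∀ y ∈ S, ∀ m, T.dist x y = T.dist x m + T.dist m y → m ∈ S

lemma PathClosed.exists_walk (hT : T.Connected) {S : Set W} (hS : PathClosed T S) :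
    ∀ (n : ℕ) (x y : S), T.dist (x : W) y = n → ∃ p : (T.induce S).Walk x y, p.length = n := by
  intro n
  induction n with
  | zero =>
    intro x y h
    have : x = y := Subtype.ext (hT.dist_eq_zero_iff.1 h)
    subst this
    exact ⟨.nil, rfl⟩
  | succ n ih =>
    intro x y h
    have hne : (x : W) ≠ y := by
      intro h'
      rw [h', T.dist_self] at h
      omega
    obtain ⟨m, hadj, hm⟩ := exists_adj_dist_eq hT hne
    have h1 := SimpleGraph.dist_eq_one_iff_adj.2 hadj
    obtain ⟨p, hp⟩ := ih ⟨m, hS x x.2 y y.2 m (by omega)⟩ y (by simp only; omega)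
    exact ⟨.cons (show (T.induce S).Adj x ⟨m, _⟩ from hadj) p, by simp [hp]⟩

lemma PathClosed.isTree_induce (hT : T.IsTree) {S : Set W} (hS : PathClosed T S)
    (hne : S.Nonempty) : (T.induce S).IsTree where
  connected := by
    have := hne.to_subtype
    refine ⟨fun x y => ?_⟩
    obtain ⟨p, -⟩ := hS.exists_walk hT.connected _ x y rfl
    exact ⟨p⟩
  isAcyclic := hT.isAcyclic.induce S

lemma PathClosed.dist_induce (hT : T.IsTree) {S : Set W} (hS : PathClosed T S) (x y : S) :
    (T.induce S).dist x y = T.dist (x : W) y := by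
  have hc := (hS.isTree_induce hT ⟨x, x.2⟩).connected
  obtain ⟨p, hp⟩ := hS.exists_walk hT.connected _ x y rfl
  obtain ⟨q, hq⟩ := hc.exists_walk_length_eq_dist x y
  refine le_antisymm (hp ▸ (T.induce S).dist_le p) ?_
  have := T.dist_le (q.map (SimpleGraph.Embedding.induce S).toHom)
  rw [SimpleGraph.Walk.length_map, hq] at this
  exact this

/-- A path inside `S` is also a path of `T`, hence the only one between its ends. -/
lemma pathClosed_of_connected_induce (hT : T.IsTree) {S : Set W} (hS : (T.induce S).Connected) :
    PathClosed T S := by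
  intro x hx y hy m hm
  obtain ⟨q, hq⟩ := hS.exists_isPath ⟨x, hx⟩ ⟨y, hy⟩
  obtain ⟨p1, hp1⟩ := hT.connected.exists_walk_length_eq_dist x m
  obtain ⟨p2, hp2⟩ := hT.connected.exists_walk_length_eq_dist m y
  have hpath : (p1.append p2).IsPath := by
    apply SimpleGraph.Walk.isPath_of_length_eq_dist
    rw [SimpleGraph.Walk.length_append]
    omega
  obtain ⟨r, hr, hrS⟩ : ∃ r : T.Walk x y, r.IsPath ∧ ∀ z ∈ r.support, z ∈ S := by
    refine ⟨q.map (SimpleGraph.Embedding.induce S).toHom, hq.map Subtype.val_injective, ?_⟩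
    intro z hz
    obtain ⟨z', -, hz'⟩ := List.mem_map.1 (Eq.mp (congrArg (z ∈ ·)
      (SimpleGraph.Walk.support_map (SimpleGraph.Embedding.induce S).toHom q)) hz)
    exact hz' ▸ z'.2
  rw [(hT.existsUnique_path x y).unique hr hpath] at hrS
  exact hrS m (by simp)

lemma pathClosed_geodesics (hT : T.IsTree) (x₀ : W) (A : Set W) :
    PathClosed T {w | ∃ y ∈ A, T.dist x₀ y = T.dist x₀ w + T.dist w y} := by
  rintro w₁ ⟨y₁, hy₁, h₁⟩ w₂ ⟨y₂, hy₂, h₂⟩ m hm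
  rcases dist_eq_or_dist_eq hT hm x₀ with h | h
  · refine ⟨y₁, hy₁, ?_⟩
    have := hT.connected.dist_triangle (u := m) (v := w₁) (w := y₁)
    have := hT.connected.dist_triangle (u := x₀) (v := m) (w := y₁)
    omega
  · refine ⟨y₂, hy₂, ?_⟩
    have := hT.connected.dist_triangle (u := m) (v := w₂) (w := y₂)
    have := hT.connected.dist_triangle (u := x₀) (v := m) (w := y₂)
    omega

/-- `T⟨A⟩` is the union of the paths from a fixed node of `A` to the nodes of `A`. -/
lemma mem_subtreeNodes_iff (hT : T.IsTree) {A : Set W} {x₀ : W} (hx₀ : x₀ ∈ A) (w : W) :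
    w ∈ subtreeNodes T A ↔ ∃ y ∈ A, T.dist x₀ y = T.dist x₀ w + T.dist w y := by
  constructor
  · intro h
    refine h {w | ∃ y ∈ A, T.dist x₀ y = T.dist x₀ w + T.dist w y}
      ⟨fun y hy => ⟨y, hy, by simp⟩, ?_⟩
    exact ((pathClosed_geodesics hT x₀ A).isTree_induce hT ⟨x₀, x₀, hx₀, by simp⟩).connected
  · rintro ⟨y, hy, h⟩ S ⟨hAS, hS⟩
    exact pathClosed_of_connected_induce hT hS _ (hAS hx₀) _ (hAS hy) _ h

lemma subset_subtreeNodes (A : Set W) : A ⊆ subtreeNodes T A :=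
  fun _ ha _ hS => hS.1 ha

lemma pathClosed_subtreeNodes (hT : T.IsTree) (A : Set W) : PathClosed T (subtreeNodes T A) :=
  fun x hx y hy m hm S hS =>
    pathClosed_of_connected_induce hT hS.2 x (hx S hS) y (hy S hS) m hm

/-- A node of `T⟨A⟩` is not further from `w` than some node of `A`. -/
lemma exists_dist_le_of_mem_subtreeNodes (hT : T.IsTree) {A : Set W} (hA : A.Nonempty) {w' : W}
    (hw' : w' ∈ subtreeNodes T A) (w : W) : ∃ x ∈ A, T.dist w w' ≤ T.dist w x := by
  obtain ⟨x₀, hx₀⟩ := hA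
  obtain ⟨y, hy, h⟩ := (mem_subtreeNodes_iff hT hx₀ w').1 hw'
  rcases dist_eq_or_dist_eq hT h w with h | h
  · exact ⟨x₀, hx₀, by omega⟩
  · exact ⟨y, hy, by omega⟩

lemma edist_subtree (hT : T.IsTree) {A : Set W} (w w' : subtreeNodes T A) :
    (subtree T A).edist w w' = (T.dist (w : W) w' : ℕ∞) := by
  have hc := pathClosed_subtreeNodes hT A
  rw [← hc.dist_induce hT, SimpleGraph.Reachable.coe_dist_eq_edist]
  exact (hc.isTree_induce hT ⟨w, w.2⟩).connected w w'

lemma eccent_subtree_le_iff (hT : T.IsTree) {A : Set W} (hA : A.Nonempty) (w : subtreeNodes T A)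
    (k : ℕ) : (subtree T A).eccent w ≤ k ↔ ∀ x ∈ A, T.dist (w : W) x ≤ k := by
  rw [SimpleGraph.eccent_le_iff]
  constructor
  · intro h x hx
    have := h ⟨x, subset_subtreeNodes A hx⟩
    rw [edist_subtree hT] at this
    exact_mod_cast this
  · intro h w'
    rw [edist_subtree hT]
    obtain ⟨x, hx, hle⟩ := exists_dist_le_of_mem_subtreeNodes hT hA w'.2 w
    exact_mod_cast hle.trans (h x hx)

lemma le_eccent_subtree (hT : T.IsTree) {A : Set W} (w : subtreeNodes T A) {x : W} (hx : x ∈ A) :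
    (T.dist (w : W) x : ℕ∞) ≤ (subtree T A).eccent w := by
  have := SimpleGraph.edist_le_eccent (G := subtree T A) (u := w)
    (v := ⟨x, subset_subtreeNodes A hx⟩)
  rwa [edist_subtree hT] at this

lemma ediam_subtree_eq (hT : T.IsTree) {A : Set W} {ℓ : ℕ}
    (hle : ∀ x ∈ A, ∀ y ∈ A, T.dist x y ≤ ℓ) {x₁ x₂ : W} (h₁ : x₁ ∈ A) (h₂ : x₂ ∈ A)
    (h : T.dist x₁ x₂ = ℓ) : (subtree T A).ediam = ℓ := by
  apply le_antisymm
  · rw [SimpleGraph.ediam_le_iff]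
    intro w w'
    rw [edist_subtree hT]
    obtain ⟨x, hx, hx'⟩ := exists_dist_le_of_mem_subtreeNodes hT ⟨_, h₁⟩ w'.2 w
    obtain ⟨y, hy, hy'⟩ := exists_dist_le_of_mem_subtreeNodes hT ⟨_, h₁⟩ w.2 x
    have := hle x hx y hy
    rw [dist_swap T x w] at hy'
    exact_mod_cast (by omega : T.dist (w : W) w' ≤ ℓ)
  · have := SimpleGraph.edist_le_ediam (G := subtree T A)
      (u := ⟨x₁, subset_subtreeNodes A h₁⟩) (v := ⟨x₂, subset_subtreeNodes A h₂⟩)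
    rw [edist_subtree hT] at this
    simpa [h] using this

/-- The center of `T⟨A⟩` when the middle of a longest path is a node. -/
lemma subtreeCenter_eq_singleton (hT : T.IsTree) {A : Set W} {k : ℕ} {x₁ x₂ c : W} (h₁ : x₁ ∈ A)
    (h₂ : x₂ ∈ A) (hc₁ : T.dist c x₁ = k) (hc₂ : T.dist c x₂ = k) (h : T.dist x₁ x₂ = k + k)
    (hk : ∀ x ∈ A, T.dist c x ≤ k) : subtreeCenter T A = {c} := by
  have hcomm := dist_swap T x₁ c
  have hcN : c ∈ subtreeNodes T A := (mem_subtreeNodes_iff hT h₁ c).2 ⟨x₂, h₂, by omega⟩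
  -- Every node reaches `x₁` or `x₂` through `c`, so moving away from `c` raises the eccentricity by
  -- at least the distance moved.
  have hlow : ∀ w : subtreeNodes T A, ((T.dist (w : W) c + k : ℕ) : ℕ∞) ≤ (subtree T A).eccent w := by
    intro w
    rcases dist_eq_or_dist_eq hT (y := x₁) (m := c) (w := x₂) (by omega) w with h' | h'
    · exact le_trans (by rw [h', hc₁]) (le_eccent_subtree hT w h₁)
    · exact le_trans (by rw [h', hc₂]) (le_eccent_subtree hT w h₂)
  have hup := (eccent_subtree_le_iff hT ⟨_, h₁⟩ ⟨c, hcN⟩ k).2 hk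
  have hrad : (subtree T A).radius = k := by
    apply le_antisymm (SimpleGraph.radius_le_eccent.trans hup)
    refine le_iInf fun w => le_trans ?_ (hlow w)
    exact_mod_cast Nat.le_add_left _ _
  ext w
  simp only [subtreeCenter, Set.mem_image, Set.mem_singleton_iff]
  constructor
  · rintro ⟨w', hw', rfl⟩
    rw [SimpleGraph.mem_center_iff, hrad] at hw'
    have := hlow w'
    rw [hw'] at this
    have h0 : T.dist (w' : W) c + k ≤ k := by exact_mod_cast this
    exact hT.connected.dist_eq_zero_iff.1 (by omega)
  · rintro rfl
    refine ⟨⟨w, hcN⟩, ?_, rfl⟩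
    rw [SimpleGraph.mem_center_iff]
    exact le_antisymm (hrad ▸ hup) SimpleGraph.radius_le_eccent

/-- The center of `T⟨A⟩` when the middle of a longest path is an edge. -/
lemma subtreeCenter_eq_pair (hT : T.IsTree) {A : Set W} {k : ℕ} {x₁ x₂ a b : W} (h₁ : x₁ ∈ A)
    (h₂ : x₂ ∈ A) (hab : T.Adj a b) (ha₁ : T.dist a x₁ = k) (ha₂ : T.dist a x₂ = k + 1)
    (hb₁ : T.dist b x₁ = k + 1) (hb₂ : T.dist b x₂ = k) (h : T.dist x₁ x₂ = k + k + 1)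
    (hka : ∀ x ∈ A, T.dist a x ≤ k + 1) (hkb : ∀ x ∈ A, T.dist b x ≤ k + 1) :
    subtreeCenter T A = {a, b} := by
  have hcomma := dist_swap T x₁ a
  have hcommb := dist_swap T x₁ b
  have haN : a ∈ subtreeNodes T A := (mem_subtreeNodes_iff hT h₁ a).2 ⟨x₂, h₂, by omega⟩
  have hbN : b ∈ subtreeNodes T A := (mem_subtreeNodes_iff hT h₁ b).2 ⟨x₂, h₂, by omega⟩
  have hlowa : ∀ w : subtreeNodes T A,
      ((T.dist (w : W) a + k : ℕ) : ℕ∞) ≤ (subtree T A).eccent w := by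
    intro w
    rcases dist_eq_or_dist_eq hT (y := x₁) (m := a) (w := x₂) (by omega) w with h' | h'
    · exact le_trans (by rw [h', ha₁]) (le_eccent_subtree hT w h₁)
    · refine le_trans ?_ (le_eccent_subtree hT w h₂)
      exact_mod_cast (by omega)
  have hlowb : ∀ w : subtreeNodes T A,
      ((T.dist (w : W) b + k : ℕ) : ℕ∞) ≤ (subtree T A).eccent w := by
    intro w
    rcases dist_eq_or_dist_eq hT (y := x₁) (m := b) (w := x₂) (by omega) w with h' | h'
    · refine le_trans ?_ (le_eccent_subtree hT w h₁)
      exact_mod_cast (by omega)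
    · exact le_trans (by rw [h', hb₂]) (le_eccent_subtree hT w h₂)
  have hupa := (eccent_subtree_le_iff hT ⟨_, h₁⟩ ⟨a, haN⟩ (k + 1)).2 hka
  have hupb := (eccent_subtree_le_iff hT ⟨_, h₁⟩ ⟨b, hbN⟩ (k + 1)).2 hkb
  have hrad : (subtree T A).radius = (k + 1 : ℕ) := by
    apply le_antisymm (SimpleGraph.radius_le_eccent.trans hupa)
    refine le_iInf fun w => ?_
    have hne := hT.dist_ne_of_adj w hab
    by_cases h0 : T.dist (w : W) a = 0
    · refine le_trans ?_ (hlowb w)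
      exact_mod_cast (by omega)
    · refine le_trans ?_ (hlowa w)
      exact_mod_cast (by omega)
  ext w
  simp only [subtreeCenter, Set.mem_image, Set.mem_insert_iff, Set.mem_singleton_iff]
  constructor
  · rintro ⟨w', hw', rfl⟩
    rw [SimpleGraph.mem_center_iff, hrad] at hw'
    have hla := hlowa w'
    have hlb := hlowb w'
    rw [hw'] at hla hlb
    have h0 : T.dist (w' : W) a + k ≤ k + 1 := by exact_mod_cast hla
    have h0' : T.dist (w' : W) b + k ≤ k + 1 := by exact_mod_cast hlb
    exact eq_or_eq_of_dist_le_one hT hab (by omega) (by omega)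
  · rintro (rfl | rfl)
    · exact ⟨⟨w, haN⟩, le_antisymm (hrad ▸ hupa) SimpleGraph.radius_le_eccent, rfl⟩
    · exact ⟨⟨w, hbN⟩, le_antisymm (hrad ▸ hupb) SimpleGraph.radius_le_eccent, rfl⟩

end Tree

/-! ### Gluing trees along an edge or a path. -/

section Join

/-- The graph obtained from disjoint copies of `T₁` and `T₂` by adding an edge between `z` in the
first copy and `v` in the second. -/
abbrev join {W₁ W₂ : Type*} (T₁ : SimpleGraph W₁) (T₂ : SimpleGraph W₂) (z : W₁) (v : W₂) :
    SimpleGraph (W₁ ⊕ W₂) :=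
  (T₁ ⊕g T₂) ⊔ SimpleGraph.edge (Sum.inl z) (Sum.inr v)

variable {W₁ W₂ : Type*} {T₁ : SimpleGraph W₁} {T₂ : SimpleGraph W₂}

lemma reachable_of_forall_adj {W : Type*} {T : SimpleGraph W} (Q : W → Prop)
    (hQ : ∀ x y, T.Adj x y → Q x → Q y) {a b : W} (h : T.Reachable a b) (ha : Q a) : Q b := by
  obtain ⟨p⟩ := h
  induction p with
  | nil => exact ha
  | cons hadj p ih => exact ih (hQ _ _ hadj ha)

lemma isAcyclic_sum (h₁ : T₁.IsAcyclic) (h₂ : T₂.IsAcyclic) : (T₁ ⊕g T₂).IsAcyclic := by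
  rw [SimpleGraph.isAcyclic_iff_forall_adj_isBridge] at *
  rintro (x | x) (y | y) hxy
  · have hb := h₁ (by simpa using hxy)
    rw [SimpleGraph.isBridge_iff] at *
    intro hr
    apply hb
    refine reachable_of_forall_adj (fun w => Sum.elim
      (fun w => (T₁.deleteEdges {s(x, y)}).Reachable x w) (fun _ => False) w) ?_ hr
      (SimpleGraph.Reachable.refl _)
    rintro (a | a) (b | b) hab ha
    · refine SimpleGraph.Reachable.trans ha (SimpleGraph.Adj.reachable ?_)
      simpa using hab
    all_goals simp at hab ha
  · simp at hxy
  · simp at hxy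
  · have hb := h₂ (by simpa using hxy)
    rw [SimpleGraph.isBridge_iff] at *
    intro hr
    apply hb
    refine reachable_of_forall_adj (fun w => Sum.elim (fun _ => False)
      (fun w => (T₂.deleteEdges {s(x, y)}).Reachable x w) w) ?_ hr
      (SimpleGraph.Reachable.refl _)
    rintro (a | a) (b | b) hab ha
    · simp at ha
    · simp at ha
    · simp at hab
    · refine SimpleGraph.Reachable.trans ha (SimpleGraph.Adj.reachable ?_)
      simpa using hab

lemma isTree_join (h₁ : T₁.IsTree) (h₂ : T₂.IsTree) (z : W₁) (v : W₂) :
    (join T₁ T₂ z v).IsTree where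
  connected := h₁.connected.sum_sup_edge h₂.connected
  isAcyclic := (isAcyclic_sum h₁.isAcyclic h₂.isAcyclic).sup_edge_of_not_reachable
    (SimpleGraph.not_reachable_sum_inl_inr z v)

lemma join_adj_inl_inl {z : W₁} {v : W₂} {x y : W₁} :
    (join T₁ T₂ z v).Adj (Sum.inl x) (Sum.inl y) ↔ T₁.Adj x y := by
  simp [SimpleGraph.edge_adj]

lemma join_adj_inr_inr {z : W₁} {v : W₂} {x y : W₂} :
    (join T₁ T₂ z v).Adj (Sum.inr x) (Sum.inr y) ↔ T₂.Adj x y := by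
  simp [SimpleGraph.edge_adj]

lemma join_adj_inl_inr {z : W₁} {v : W₂} {x : W₁} {y : W₂} :
    (join T₁ T₂ z v).Adj (Sum.inl x) (Sum.inr y) ↔ x = z ∧ y = v := by
  simp [SimpleGraph.edge_adj]

lemma join_adj_inr_inl {z : W₁} {v : W₂} {x : W₂} {y : W₁} :
    (join T₁ T₂ z v).Adj (Sum.inr x) (Sum.inl y) ↔ y = z ∧ x = v := by
  rw [SimpleGraph.adj_comm, join_adj_inl_inr]

lemma dist_map_le {W W' : Type*} {T : SimpleGraph W} {T' : SimpleGraph W'} (hT : T.Connected)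
    (f : T →g T') (x y : W) : T'.dist (f x) (f y) ≤ T.dist x y := by
  obtain ⟨p, hp⟩ := hT.exists_walk_length_eq_dist x y
  rw [← hp, ← SimpleGraph.Walk.length_map f p]
  exact T'.dist_le _

lemma dist_adj_le {W : Type*} {T : SimpleGraph W} (hT : T.Connected) (x : W) {y y' : W}
    (h : T.Adj y y') : T.dist x y' ≤ T.dist x y + 1 := by
  have h1 := SimpleGraph.dist_eq_one_iff_adj.2 h
  have h2 := hT.dist_triangle (u := x) (v := y) (w := y')
  omega

lemma dist_join (h₁ : T₁.Connected) (h₂ : T₂.Connected) (z : W₁) (v : W₂) :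
    (∀ x y, (join T₁ T₂ z v).dist (Sum.inl x) (Sum.inl y) = T₁.dist x y) ∧
    (∀ x y, (join T₁ T₂ z v).dist (Sum.inr x) (Sum.inr y) = T₂.dist x y) ∧
    (∀ x y, (join T₁ T₂ z v).dist (Sum.inl x) (Sum.inr y) = T₁.dist x z + 1 + T₂.dist v y) := by
  have hc : (join T₁ T₂ z v).Connected := h₁.sum_sup_edge h₂
  let i : T₁ →g join T₁ T₂ z v := ⟨Sum.inl, fun h => join_adj_inl_inl.2 h⟩
  let j : T₂ →g join T₁ T₂ z v := ⟨Sum.inr, fun h => join_adj_inr_inr.2 h⟩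
  -- The expected distance grows by at most one along each edge, so it is a lower bound for the true
  -- one.
  have hl : ∀ x : W₁, ∀ w, Sum.elim (T₁.dist x) (fun y => T₁.dist x z + 1 + T₂.dist v y) w
      ≤ (join T₁ T₂ z v).dist (Sum.inl x) w := by
    intro x w
    have := le_add_dist_of_forall_adj hc
      (Sum.elim (T₁.dist x) (fun y => T₁.dist x z + 1 + T₂.dist v y)) ?_ (Sum.inl x) w
    · simpa using this
    rintro (a | a) (b | b) hab
    · exact dist_adj_le h₁ x (join_adj_inl_inl.1 hab)
    · obtain ⟨rfl, rfl⟩ := join_adj_inl_inr.1 hab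
      simp
    · obtain ⟨rfl, rfl⟩ := join_adj_inr_inl.1 hab
      simp [Nat.add_assoc]
    · have := dist_adj_le h₂ v (join_adj_inr_inr.1 hab)
      simp only [Sum.elim_inr]
      omega
  have hr : ∀ x : W₂, ∀ w, Sum.elim (fun y => T₂.dist x v + 1 + T₁.dist z y) (T₂.dist x) w
      ≤ (join T₁ T₂ z v).dist (Sum.inr x) w := by
    intro x w
    have := le_add_dist_of_forall_adj hc
      (Sum.elim (fun y => T₂.dist x v + 1 + T₁.dist z y) (T₂.dist x)) ?_ (Sum.inr x) w
    · simpa using this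
    rintro (a | a) (b | b) hab
    · have := dist_adj_le h₁ z (join_adj_inl_inl.1 hab)
      simp only [Sum.elim_inl]
      omega
    · obtain ⟨rfl, rfl⟩ := join_adj_inl_inr.1 hab
      simp [Nat.add_assoc]
    · obtain ⟨rfl, rfl⟩ := join_adj_inr_inl.1 hab
      simp
    · exact dist_adj_le h₂ x (join_adj_inr_inr.1 hab)
  refine ⟨fun x y => le_antisymm (dist_map_le h₁ i x y) (hl x (Sum.inl y)),
    fun x y => le_antisymm (dist_map_le h₂ j x y) (hr x (Sum.inr y)),
    fun x y => le_antisymm ?_ (hl x (Sum.inr y))⟩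
  have t1 := dist_map_le h₁ i x z
  have t2 := dist_map_le h₂ j v y
  have t3 : (join T₁ T₂ z v).dist (Sum.inl z) (Sum.inr v) = 1 :=
    SimpleGraph.dist_eq_one_iff_adj.2 (join_adj_inl_inr.2 ⟨rfl, rfl⟩)
  have t4 := hc.dist_triangle (u := Sum.inl x) (v := Sum.inl z) (w := Sum.inr y)
  have t5 := hc.dist_triangle (u := Sum.inl z) (v := Sum.inr v) (w := Sum.inr y)
  change (join T₁ T₂ z v).dist (Sum.inl x) (Sum.inl z) ≤ _ at t1
  change (join T₁ T₂ z v).dist (Sum.inr v) (Sum.inr y) ≤ _ at t2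
  omega

end Join

/-- A path of length `s` can be hung on the node `v` of a tree. -/
lemma exists_pendant_path {W : Type u} [Finite W] {T : SimpleGraph W} (hT : T.IsTree) (v : W)
    (s : ℕ) : ∃ (W' : Type u) (_ : Finite W') (T' : SimpleGraph W') (i : W → W') (v' : W'),
      T'.IsTree ∧ (∀ x y, T'.dist (i x) (i y) = T.dist x y) ∧
      ∀ x, T'.dist v' (i x) = s + T.dist v x := by
  induction s with
  | zero => exact ⟨W, ‹_›, T, id, v, hT, fun _ _ => rfl, fun _ => (Nat.zero_add _).symm⟩
  | succ s ih =>
    obtain ⟨W', _, T', i, v', hT', hi, hv⟩ := ih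
    have h₁ : (⊥ : SimpleGraph PUnit.{u + 1}).IsTree := SimpleGraph.IsTree.of_subsingleton
    obtain ⟨-, hr, hlr⟩ := dist_join h₁.connected hT'.connected PUnit.unit v'
    refine ⟨PUnit ⊕ W', inferInstance, join ⊥ T' PUnit.unit v', Sum.inr ∘ i,
      Sum.inl PUnit.unit, isTree_join h₁ hT' _ _, fun x y => ?_, fun x => ?_⟩
    · rw [← hi]
      exact hr _ _
    · have := hlr PUnit.unit (i x)
      rw [hv, SimpleGraph.dist_self] at this
      simp only [Function.comp_apply]
      omega

/-- Two trees can be joined by a path of positive length `t` between prescribed nodes. -/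
lemma exists_join_path {W₁ W₂ : Type u} [Finite W₁] [Finite W₂] {T₁ : SimpleGraph W₁}
    {T₂ : SimpleGraph W₂} (h₁ : T₁.IsTree) (h₂ : T₂.IsTree) (z : W₁) (v : W₂) {t : ℕ}
    (ht : 1 ≤ t) :
    ∃ (W : Type u) (_ : Finite W) (T : SimpleGraph W) (i : W₁ → W) (j : W₂ → W), T.IsTree ∧
      (∀ x y, T.dist (i x) (i y) = T₁.dist x y) ∧ (∀ x y, T.dist (j x) (j y) = T₂.dist x y) ∧
      ∀ x y, T.dist (i x) (j y) = T₁.dist x z + t + T₂.dist v y := by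
  -- The last edge of the path of length `t` is the one that joins the trees.
  obtain ⟨W₃, _, T₃, j, v', h₃, hj, hv⟩ := exists_pendant_path h₂ v (t - 1)
  obtain ⟨hl, hr, hlr⟩ := dist_join h₁.connected h₃.connected z v'
  refine ⟨W₁ ⊕ W₃, inferInstance, join T₁ T₃ z v', Sum.inl, Sum.inr ∘ j,
    isTree_join h₁ h₃ _ _, hl, fun x y => ?_, fun x y => ?_⟩
  · rw [← hj]
    exact hr _ _
  · have := hlr x (j y)
    rw [hv] at this
    simp only [Function.comp_apply]
    omega

/-! ### Root metrics and the cut-and-reattach operation. -/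

section Roots

variable {V : Type u} {G : SimpleGraph V}

/-- The functions on pairs of vertices of `G` that are the distances in some `4`-Steiner root. -/
def IsRootDist (G : SimpleGraph V) (d : V → V → ℕ) : Prop :=
  ∃ (W : Type u) (_ : Finite W) (T : SimpleGraph W) (f : G ↪g power T 4), T.IsTree ∧
    ∀ x y, T.dist (f x) (f y) = d x y

section Basic

variable {W : Type*} {T : SimpleGraph W}

lemma adj_iff_dist_le (hT : T.IsTree) (f : G ↪g power T 4) {x y : V} (h : x ≠ y) :
    G.Adj x y ↔ T.dist (f x) (f y) ≤ 4 := by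
  rw [← f.map_adj_iff]
  have := hT.connected.pos_dist_of_ne (f.injective.ne h)
  exact ⟨fun h => h.2, fun h => ⟨this, h⟩⟩

lemma dist_le_of_adj (f : G ↪g power T 4) {x y : V} (h : G.Adj x y) :
    T.dist (f x) (f y) ≤ 4 :=
  (f.map_adj_iff.2 h).2

lemma exists_embedding (f : V → W)
    (hf : ∀ x y, x ≠ y → 0 < T.dist (f x) (f y) ∧ (G.Adj x y ↔ T.dist (f x) (f y) ≤ 4)) :
    ∃ g : G ↪g power T 4, ∀ x, g x = f x := by
  have hinj : Function.Injective f := by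
    intro x y hxy
    by_contra hne
    have := (hf x y hne).1
    rw [hxy, T.dist_self] at this
    omega
  refine ⟨⟨⟨f, hinj⟩, ?_⟩, fun x => rfl⟩
  intro x y
  change (0 < T.dist (f x) (f y) ∧ T.dist (f x) (f y) ≤ 4) ↔ G.Adj x y
  by_cases hxy : x = y
  · subst hxy
    simp
  · rw [(hf x y hxy).2]
    exact ⟨fun h => h.2, fun h => ⟨(hf x y hxy).1, h⟩⟩

end Basic

/-- All neighbours of the vertices of `H` outside of `H` are equal to `v`, and `v ∉ H`. -/
structure IsSplit (G : SimpleGraph V) (v : V) (H : Set V) : Prop where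
  notMem : v ∉ H
  not_adj : ∀ x, x ∉ H → x ≠ v → ∀ y ∈ H, ¬ G.Adj x y

open Classical in
/-- The distances between vertices after the part of a root that represents `H` is separated from
the rest and reattached to `v` with a path of length `t` that starts in a node whose distances to
the vertices of `H` are given by `δ`. -/
noncomputable def cutDist (d : V → V → ℕ) (v : V) (H : Set V) (t : ℕ) (δ : V → ℕ) (x y : V) : ℕ :=
  if x ∈ H then (if y ∈ H then d x y else δ x + t + d v y)
  else (if y ∈ H then d x v + t + δ y else d x y)

/-- Take two complete copies of `T`, read `H` in one and the other vertices in the second, and join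
`z` to `v` across. The superfluous nodes become Steiner nodes, so nothing has to be cut out of `T`.
Only pairs across the cut need checking. -/
lemma isRootDist_cutDist {W : Type u} [Finite W] {T : SimpleGraph W} (hT : T.IsTree)
    (f : G ↪g power T 4) {v : V} {H : Set V} (hH : IsSplit G v H) (z : W) {t : ℕ} (ht : 1 ≤ t)
    (hv : ∀ y ∈ H, (G.Adj v y ↔ T.dist z (f y) + t ≤ 4))
    (hx : ∀ x, x ∉ H → x ≠ v → ∀ y ∈ H, 4 < T.dist (f x) (f v) + t + T.dist z (f y)) :
    IsRootDist G (cutDist (fun x y => T.dist (f x) (f y)) v H t (fun y => T.dist z (f y))) := by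
  classical
  obtain ⟨W', _, T', i, j, hT', hi, hj, hij⟩ := exists_join_path hT hT z (f v) ht
  have hd : ∀ x y, T'.dist (if x ∈ H then i (f x) else j (f x)) (if y ∈ H then i (f y) else j (f y))
      = cutDist (fun x y => T.dist (f x) (f y)) v H t (fun y => T.dist z (f y)) x y := by
    intro x y
    unfold cutDist
    split_ifs with h1 h2 h2
    · exact hi _ _
    · rw [hij, dist_swap T (f x) z]
    · rw [dist_swap T', hij, dist_swap T (f y) z, dist_swap T (f v) (f x)]
      simp only
      omega
    · exact hj _ _
  have hcross : ∀ x, x ∉ H → ∀ y ∈ H, (G.Adj x y ↔ T.dist (f x) (f v) + t + T.dist z (f y) ≤ 4) := by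
    intro x h1 y h2
    by_cases hxv : x = v
    · subst hxv
      rw [hv y h2, T.dist_self]
      omega
    · have := hx x h1 hxv y h2
      exact ⟨fun h => absurd h (hH.not_adj x h1 hxv y h2), fun h => by omega⟩
  obtain ⟨g, hg⟩ := exists_embedding (G := G) (T := T') (fun x => if x ∈ H then i (f x) else j (f x)) (by
    intro x y hxy
    rw [hd]
    have hpos := hT.connected.pos_dist_of_ne (f.injective.ne hxy)
    have hadj := adj_iff_dist_le hT f hxy
    unfold cutDist
    split_ifs with h1 h2 h2
    · exact ⟨hpos, hadj⟩
    · refine ⟨by omega, ?_⟩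
      rw [G.adj_comm, hcross y h2 x h1, dist_swap T (f y)]
      dsimp only
      constructor <;> intro <;> omega
    · exact ⟨by omega, hcross x h1 y h2⟩
    · exact ⟨hpos, hadj⟩)
  exact ⟨W', ‹_›, T', g, hT', fun x y => by rw [hg, hg, hd]⟩

lemma dist_le_four_mul (hG : G.Connected) {W : Type*} {T : SimpleGraph W} (hT : T.IsTree)
    (f : G ↪g power T 4) (x y : V) : T.dist (f x) (f y) ≤ 4 * G.dist x y := by
  obtain ⟨p, hp⟩ := hG.exists_walk_length_eq_dist x y
  rw [← hp]
  clear hp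
  induction p with
  | nil => simp
  | @cons a b c hadj p ih =>
    have h1 := dist_le_of_adj f hadj
    have h2 := hT.connected.dist_triangle (u := f a) (v := f b) (w := f c)
    rw [SimpleGraph.Walk.length_cons]
    omega

/-- A root may be restricted to the smallest subtree that contains the vertices of `G`. -/
lemma exists_spanned [Nonempty V] {d : V → V → ℕ} (hd : IsRootDist G d) :
    ∃ (W : Type u) (_ : Finite W) (T : SimpleGraph W) (f : G ↪g power T 4), T.IsTree ∧
      (∀ x y, T.dist (f x) (f y) = d x y) ∧
      ∀ x w, ∃ y, T.dist (f x) (f y) = T.dist (f x) w + T.dist w (f y) := by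
  obtain ⟨W, _, T, f, hT, hf⟩ := hd
  have hc := pathClosed_subtreeNodes hT (Set.range f)
  have hmem : ∀ x, f x ∈ subtreeNodes T (Set.range f) := fun x =>
    subset_subtreeNodes _ (Set.mem_range_self x)
  have hT' := hc.isTree_induce hT ⟨_, hmem (Classical.arbitrary V)⟩
  obtain ⟨g, hg⟩ := exists_embedding (G := G)
    (T := T.induce (subtreeNodes T (Set.range f))) (fun x => ⟨f x, hmem x⟩) (by
    intro x y hxy
    rw [hc.dist_induce hT]
    exact ⟨hT.connected.pos_dist_of_ne (f.injective.ne hxy), adj_iff_dist_le hT f hxy⟩)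
  refine ⟨_, inferInstance, _, g, hT', fun x y => ?_, fun x w => ?_⟩
  · rw [hg, hg, hc.dist_induce hT, hf]
  · obtain ⟨_, ⟨y, rfl⟩, hy⟩ := (mem_subtreeNodes_iff hT (Set.mem_range_self x) _).1 w.2
    refine ⟨y, ?_⟩
    rw [hg, hg, hc.dist_induce hT, hc.dist_induce hT, hc.dist_induce hT]
    exact hy

/-! ### The optimal root and its rigidity. -/

section Score

variable [Fintype V]

/-- `x` has distance at least two to all other vertices. -/
def IsIsolated (d : V → V → ℕ) (x : V) : Prop := ∀ y, y ≠ x → 2 ≤ d x y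

open Classical in
/-- The quantity that is maximised, lexicographically: the number of isolated vertices, the sum of
the distances to `h`, and the sum of all distances. -/
noncomputable def score (h : V) (d : V → V → ℕ) : ℕ ×ₗ ℕ ×ₗ ℕ :=
  toLex (∑ x, if IsIsolated d x then 1 else 0, toLex (∑ y, d h y, ∑ x, ∑ y, d x y))

open Classical in
lemma sum_isIsolated_le {d d' : V → V → ℕ} (h : ∀ x, IsIsolated d x → IsIsolated d' x) :
    (∑ x, if IsIsolated d x then 1 else 0) ≤ ∑ x, if IsIsolated d' x then 1 else 0 := by
  refine Finset.sum_le_sum fun x _ => ?_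
  have := h x
  split_ifs <;> simp_all

lemma score_lt_of_sum {h : V} {d d' : V → V → ℕ} (h₁ : ∀ x, IsIsolated d x → IsIsolated d' x)
    (h₂ : ∑ y, d h y < ∑ y, d' h y) : score h d < score h d' := by
  unfold score
  rw [Prod.Lex.toLex_lt_toLex]
  rcases (sum_isIsolated_le h₁).lt_or_eq with hlt | heq
  · exact Or.inl hlt
  · exact Or.inr ⟨heq, Prod.Lex.toLex_lt_toLex.2 (Or.inl h₂)⟩

lemma score_lt_of_isIsolated (h : V) {d d' : V → V → ℕ}
    (h₁ : ∀ x, IsIsolated d x → IsIsolated d' x) {x : V} (hx : ¬ IsIsolated d x)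
    (hx' : IsIsolated d' x) : score h d < score h d' := by
  classical
  unfold score
  rw [Prod.Lex.toLex_lt_toLex]
  left
  refine Finset.sum_lt_sum (fun y _ => ?_) ⟨x, Finset.mem_univ x, ?_⟩
  · have := h₁ y
    split_ifs <;> simp_all
  · simp [hx, hx']

lemma score_lt_of_le (h : V) {d d' : V → V → ℕ} (hle : ∀ x y, d x y ≤ d' x y) {x y : V}
    (hlt : d x y < d' x y) : score h d < score h d' := by
  have h₁ : ∀ x, IsIsolated d x → IsIsolated d' x :=
    fun x hx y hy => (hx y hy).trans (hle x y)
  rcases (Finset.sum_le_sum fun y (_ : y ∈ Finset.univ) => hle h y).lt_or_eq with h₂ | h₂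
  · exact score_lt_of_sum h₁ h₂
  · unfold score
    rw [Prod.Lex.toLex_lt_toLex]
    rcases (sum_isIsolated_le h₁).lt_or_eq with hlt | heq
    · exact Or.inl hlt
    · refine Or.inr ⟨heq, Prod.Lex.toLex_lt_toLex.2 (Or.inr ⟨h₂, ?_⟩)⟩
      refine Finset.sum_lt_sum (fun x _ => Finset.sum_le_sum fun y _ => hle x y)
        ⟨x, Finset.mem_univ x, ?_⟩
      exact Finset.sum_lt_sum (fun y _ => hle x y) ⟨y, Finset.mem_univ y, hlt⟩

/-- A root that maximises the score and whose nodes all lie on paths between vertices of `G`. -/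
structure IsOptimal (h : V) {W : Type u} (T : SimpleGraph W) (f : G ↪g power T 4) : Prop where
  isTree : T.IsTree
  not_score_lt : ∀ d, IsRootDist G d → ¬ score h (fun x y => T.dist (f x) (f y)) < score h d
  span : ∀ x w, ∃ y, T.dist (f x) (f y) = T.dist (f x) w + T.dist w (f y)

/-- Roots have unbounded size, but the score sees only distances between vertices of `G`. These are
at most four times the distances in `G`, so finitely many candidates remain. Pruning keeps them. -/
lemma exists_isOptimal (hG : G.Connected) (hS : IsSteinerPower 4 G) (h : V) :
    ∃ (W : Type u) (_ : Finite W) (T : SimpleGraph W) (f : G ↪g power T 4), IsOptimal h T f := by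
  have : Nonempty V := ⟨h⟩
  have hfin : {d | IsRootDist G d}.Finite := by
    refine (Set.Finite.pi' fun x => Set.Finite.pi' fun y =>
      Set.finite_Iic (4 * G.dist x y)).subset ?_
    rintro d ⟨W, _, T, f, hT, hf⟩ x y
    rw [Set.mem_Iic, ← hf]
    exact dist_le_four_mul hG hT f x y
  have hne : {d | IsRootDist G d}.Nonempty := by
    obtain ⟨W, hW, T, hT, ⟨f⟩⟩ := hS
    exact ⟨_, W, hW, T, f, hT, fun _ _ => rfl⟩
  obtain ⟨d, hd, hmax⟩ := Set.exists_max_image _ (score h) hfin hne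
  obtain ⟨W, hW, T, f, hT, hf, hspan⟩ := exists_spanned hd
  refine ⟨W, hW, T, f, hT, fun d' hd' => ?_, hspan⟩
  have : (fun x y => T.dist (f x) (f y)) = d := by
    funext x y
    exact hf x y
  rw [this]
  exact not_lt.2 (hmax d' hd')

/-- In an optimal root, the part that represents `H` cannot be moved away from `v`. -/
lemma IsOptimal.dist_eq {h : V} {W : Type u} [Finite W] {T : SimpleGraph W} {f : G ↪g power T 4}
    (hO : IsOptimal h T f) {v : V} {H : Set V} (hH : IsSplit G v H) (z : W) {t : ℕ} (ht : 1 ≤ t)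
    (hα : ∀ y ∈ H, G.Adj v y → T.dist z (f y) + t ≤ 4) (hγ : T.dist (f v) z ≤ t) :
    ∀ x, x ∉ H → ∀ y ∈ H, T.dist (f x) (f y) = T.dist (f x) (f v) + t + T.dist z (f y) := by
  have hT := hO.isTree
  -- Since `dist(v, z) ≤ t`, the reattached distances dominate the old ones. Hence nonadjacent pairs
  -- stay nonadjacent, and any strict increase would raise the score.
  have hcross : ∀ x y, T.dist (f x) (f y) ≤ T.dist (f x) (f v) + t + T.dist z (f y) := by
    intro x y
    have h1 := hT.connected.dist_triangle (u := f x) (v := f v) (w := f y)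
    have h2 := hT.connected.dist_triangle (u := f v) (v := z) (w := f y)
    omega
  have hroot : IsRootDist G
      (cutDist (fun x y => T.dist (f x) (f y)) v H t (fun y => T.dist z (f y))) := by
    refine isRootDist_cutDist hT f hH z ht (fun y hy => ⟨hα y hy, fun hle => ?_⟩)
      (fun x hx hxv y hy => ?_)
    · have hne : v ≠ y := by
        rintro rfl
        exact hH.notMem hy
      rw [adj_iff_dist_le hT f hne]
      have h1 := hcross v y
      rw [T.dist_self] at h1
      omega
    · have hne : x ≠ y := by
        rintro rfl
        exact hx hy
      have h1 := hH.not_adj x hx hxv y hy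
      rw [adj_iff_dist_le hT f hne] at h1
      have := hcross x y
      omega
  intro x hx y hy
  refine le_antisymm (hcross x y) (not_lt.1 fun hlt => hO.not_score_lt _ hroot ?_)
  refine score_lt_of_le h (x := x) (y := y) (fun a b => ?_) (by simpa [cutDist, hx, hy] using hlt)
  unfold cutDist
  split_ifs
  · rfl
  · have := hcross b a
    rw [dist_swap T (f b) (f v)] at this
    rw [dist_swap T (f a)]
    dsimp only
    omega
  · exact hcross a b
  · rfl

end Score

end Roots

/-! ### Free vertices as separators. -/

section Free

variable {V : Type u} {G : SimpleGraph V}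

/-- The union of the maximal cliques that contain `X`. -/
def cliqueHull (G : SimpleGraph V) (X : Set V) : Set V :=
  {y | ∃ K, Maximal G.IsClique K ∧ X ⊆ K ∧ y ∈ K}

lemma exists_maximal_isClique_ge [Finite V] {S : Set V} (hS : G.IsClique S) :
    ∃ K, S ⊆ K ∧ Maximal G.IsClique K := by
  obtain ⟨K, hK, hmax⟩ := (Set.toFinite {K : Set V | G.IsClique K}).exists_le_maximal hS
  exact ⟨K, hK, hmax⟩

lemma mem_cliqueIntersections_of_maximal {K : Set V} (hK : Maximal G.IsClique K) :
    K ∈ cliqueIntersections G :=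
  ⟨{K}, Set.singleton_nonempty K, by simpa using hK, by simp⟩

lemma inter_mem_cliqueIntersections {X K : Set V} (hX : X ∈ cliqueIntersections G)
    (hK : Maximal G.IsClique K) : X ∩ K ∈ cliqueIntersections G := by
  obtain ⟨F, -, hF, rfl⟩ := hX
  refine ⟨insert K F, Set.insert_nonempty K F, ?_, ?_⟩
  · rintro L (rfl | hL)
    · exact hK
    · exact hF L hL
  · rw [Set.sInter_insert, Set.inter_comm]

lemma subset_cliqueHull {X : Set V} (hX : X ∈ cliqueIntersections G) : X ⊆ cliqueHull G X := by
  obtain ⟨F, ⟨K, hK⟩, hF, rfl⟩ := hX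
  exact fun x hx => ⟨K, hF K hK, Set.sInter_subset_of_mem hK, hx K hK⟩

lemma adj_of_mem_cliqueHull {X : Set V} {x y : V} (hx : x ∈ X) (hy : y ∈ cliqueHull G X)
    (h : x ≠ y) : G.Adj x y := by
  obtain ⟨K, hK, hXK, hyK⟩ := hy
  exact hK.prop (hXK hx) hyK h

lemma cliqueHull_eq_of_maximal {K : Set V} (hK : Maximal G.IsClique K) : cliqueHull G K = K := by
  ext y
  constructor
  · rintro ⟨L, hL, hKL, hy⟩
    exact hK.le_of_ge hL.prop hKL hy
  · exact fun hy => ⟨K, hK, subset_rfl, hy⟩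

/-- If `X = {v}`, a maximal clique through `v` and a neighbour of `v`, used as both `X₁` and `X₂`,
sandwiches `v`. -/
lemma exists_ne_of_isFree [Finite V] [Nontrivial V] (hG : G.Connected) {X : Set V}
    {v : V} (hv : IsFree G X v) : ∃ u ∈ X, u ≠ v := by
  by_contra! hne
  have hXv : X = {v} := Set.Subset.antisymm (fun u hu => hne u hu) (by simpa using hv.1)
  obtain ⟨u, hu⟩ := hG.preconnected.exists_adj_of_nontrivial v
  obtain ⟨K, hSK, hK⟩ := exists_maximal_isClique_ge (G := G) (S := {v, u})
    (by rw [SimpleGraph.isClique_pair]; exact fun _ => hu)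
  have hvK : v ∈ K := hSK (by simp)
  have huK : u ∈ K := hSK (by simp)
  have hlt : ({v} : Set V) ⊂ K := by
    refine ⟨by simpa using hvK, fun hle => hu.ne' (hle huK)⟩
  refine hv.2 (Or.inr ⟨K, mem_cliqueIntersections_of_maximal hK, K,
    mem_cliqueIntersections_of_maximal hK, hXv ▸ hlt, ?_, by rwa [Set.inter_self]⟩)
  rw [hXv, Set.inter_eq_left]
  simpa using hvK

/-- Neighbours of an `X`-free vertex inside and outside of the hull of `X` are not adjacent. -/
lemma not_adj_of_isFree [Finite V] {X : Set V} (hX : X ∈ cliqueIntersections G) {v : V}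
    (hv : IsFree G X v) {y w : V} (hy : y ∈ cliqueHull G X) (hyv : y ≠ v) (hw : G.Adj v w)
    (hwX : w ∉ cliqueHull G X) : ¬ G.Adj y w := by
  intro hyw
  have hvy := adj_of_mem_cliqueHull hv.1 hy hyv.symm
  obtain ⟨K, hSK, hK⟩ := exists_maximal_isClique_ge (G := G) (S := {v, y, w}) (by
    rw [SimpleGraph.isClique_insert, SimpleGraph.isClique_pair]
    refine ⟨fun _ => hyw, ?_⟩
    rintro b (rfl | rfl) -
    · exact hvy
    · exact hw)
  have hvK : v ∈ K := hSK (by simp)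
  have hyK : y ∈ K := hSK (by simp)
  have hwK : w ∈ K := hSK (by simp)
  -- So `X ∩ K` is a proper clique-intersection inside `X` containing `v`; lack of internal
  -- constraint shrinks it to `{v}`. Then `y` either lies in it, or `K₁` and `K` sandwich `v`.
  have hXK : ¬ X ⊆ K := fun h => hwX ⟨K, hK, h, hwK⟩
  have hI := inter_mem_cliqueIntersections hX hK
  have hss : X ∩ K ⊂ X :=
    ⟨Set.inter_subset_left, fun h => hXK (h.trans Set.inter_subset_right)⟩
  have hIv : X ∩ K = {v} := by
    refine Set.Subset.antisymm (fun u hu => ?_) (by simpa using ⟨hv.1, hvK⟩)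
    by_contra huv
    refine hv.2 (Or.inl ⟨X ∩ K, hI, hss, ⟨hv.1, hvK⟩, ?_⟩)
    have : ({u, v} : Set V) ⊆ X ∩ K := by
      rintro a (rfl | rfl)
      · exact hu
      · exact ⟨hv.1, hvK⟩
    refine le_trans (le_of_eq ?_) (Set.encard_le_encard this)
    rw [Set.encard_pair huv]
  obtain ⟨K₁, hK₁, hXK₁, hyK₁⟩ := hy
  by_cases hXe : K₁ ⊆ X
  · have : y ∈ X ∩ K := ⟨hXe hyK₁, hyK⟩
    rw [hIv] at this
    exact hyv this
  · refine hv.2 (Or.inr ⟨K₁, mem_cliqueIntersections_of_maximal hK₁, K,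
      mem_cliqueIntersections_of_maximal hK, ⟨hXK₁, hXe⟩, hIv, ?_⟩)
    exact ⟨by simpa using ⟨hXK₁ hv.1, hvK⟩, fun h => hyv (h ⟨hyK₁, hyK⟩)⟩

/-- In a `4`-Steiner power, a union `D` of components of the graph induced by the neighbours of `v`
is separated by `v` from the other neighbours of `v`. -/
lemma exists_isSplit {W : Type*} {T : SimpleGraph W} (hT : T.IsTree) (f : G ↪g power T 4) {v : V}
    {D : Set V} (hD : ∀ y ∈ D, G.Adj v y)
    (hsep : ∀ y ∈ D, ∀ w, G.Adj v w → w ∉ D → ¬ G.Adj y w) :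
    ∃ H, IsSplit G v H ∧ D ⊆ H ∧ ∀ y ∈ H, G.Adj v y → y ∈ D := by
  -- `H` is `D` together with all that is reached from it through vertices outside the closed
  -- neighbourhood of `v`.
  let r : V → V → Prop := fun a b => G.Adj a b ∧ b ≠ v ∧ ¬ G.Adj v b
  have hmem : ∀ {y p}, y ∈ D → Relation.ReflTransGen r y p → p = y ∨ (p ≠ v ∧ ¬ G.Adj v p) := by
    intro y p hy hp
    rcases hp.cases_tail with h | ⟨q, -, h⟩
    · exact Or.inl h
    · exact Or.inr h.2
  refine ⟨{p | ∃ y ∈ D, Relation.ReflTransGen r y p}, ⟨?_, ?_⟩, ?_, ?_⟩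
  · rintro ⟨y, hy, hp⟩
    rcases hmem hy hp with rfl | h
    · exact (hD _ hy).ne rfl
    · exact h.1 rfl
  · rintro w hw hwv p ⟨y, hy, hp⟩ hwp
    have hvw : G.Adj v w := by
      by_contra hvw
      exact hw ⟨y, hy, hp.tail ⟨hwp.symm, hwv, hvw⟩⟩
    have hwD : w ∉ D := fun h => hw ⟨w, h, .refl⟩
    have hyw := hsep y hy w hvw hwD
    have hne : y ≠ w := fun h => hwD (h ▸ hy)
    rw [adj_iff_dist_le hT f hne] at hyw
    have hvy := dist_le_of_adj f (hD y hy)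
    have hvw' := dist_le_of_adj f hvw
    -- As `y` and `w` are at distance at least five but within four of `v`, the median `m` is within
    -- one of `v`, and `y`, `w` are both further from `m` than `v` is.
    obtain ⟨m, h1, h2, h3⟩ := exists_median hT (f y) (f w) (f v)
    have s1 := dist_swap T m (f y)
    have far : ∀ q, q ≠ v → ¬ G.Adj v q → 5 ≤ T.dist (f v) m + T.dist (f q) m := by
      intro q hq hvq
      rw [adj_iff_dist_le hT f hq.symm] at hvq
      have := hT.connected.dist_triangle (u := f v) (v := m) (w := f q)
      rw [dist_swap T (f q) m]
      omega
    -- A nonneighbour of `v` is so far from `m` that no edge of `G` can jump over `m`; the chain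
    -- never leaves the side of `y`, and so cannot connect to `w`.
    have chain : ∀ q, Relation.ReflTransGen r y q →
        T.dist (f q) (f y) ≠ T.dist (f q) m + T.dist m (f y) := by
      intro q hq
      induction hq with
      | refl =>
        rw [T.dist_self]
        omega
      | @tail a b hya hab ih =>
        intro hB
        have h4 := dist_le_of_adj f hab.1
        have h5 := far b hab.2.1 hab.2.2
        rcases dist_eq_or_dist_eq hT hB (f a) with h6 | h6
        · rw [dist_swap T m (f b)] at h6
          rcases hmem hy hya with rfl | h7
          · omega
          · have := far a h7.1 h7.2
            omega
        · exact ih h6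
    have h4 := dist_le_of_adj f hwp
    rw [dist_swap T (f w)] at h4
    rcases dist_eq_or_dist_eq hT h1 (f p) with h6 | h6
    · exact chain p hp h6
    · rcases hmem hy hp with rfl | h7
      · omega
      · have := far p h7.1 h7.2
        omega
  · exact fun y hy => ⟨y, hy, .refl⟩
  · rintro p ⟨y, hy, hp⟩ hvp
    rcases hmem hy hp with rfl | h
    · exact hy
    · exact absurd hvp h.2

/-- `H` is a part of the graph that `v` separates from the rest, and whose neighbours of `v` are
the vertices of the hull of `X` other than `v`. -/
structure IsSide (G : SimpleGraph V) (X : Set V) (v : V) (H : Set V) : Prop extends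
    IsSplit G v H where
  mem_of_mem_cliqueHull : ∀ y ∈ cliqueHull G X, y ≠ v → y ∈ H
  mem_cliqueHull : ∀ y ∈ H, G.Adj v y → y ∈ cliqueHull G X

lemma IsFree.exists_isSide [Finite V] {W : Type*} {T : SimpleGraph W} (hT : T.IsTree)
    (f : G ↪g power T 4) {X : Set V} (hX : X ∈ cliqueIntersections G) {v : V}
    (hv : IsFree G X v) : ∃ H, IsSide G X v H := by
  obtain ⟨H, hH, hDH, hHD⟩ := exists_isSplit hT f (v := v) (D := cliqueHull G X \ {v})
    (fun y hy => adj_of_mem_cliqueHull hv.1 hy.1 (Ne.symm hy.2))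
    (fun y hy w hvw hw => not_adj_of_isFree hX hv hy.1 hy.2 hvw
      (fun h => hw ⟨h, hvw.ne'⟩))
  exact ⟨H, hH, fun y hy hyv => hDH ⟨hy, hyv⟩, fun y hy hvy => (hHD y hy hvy).1⟩

lemma IsOptimal.dist_eq_of_isSide [Fintype V] {h : V} {W : Type u} [Finite W]
    {T : SimpleGraph W} {f : G ↪g power T 4} (hO : IsOptimal h T f) {X : Set V} {v : V}
    {H : Set V} (hH : IsSide G X v H) (z : W) {t : ℕ} (ht : 1 ≤ t)
    (hα : ∀ y ∈ cliqueHull G X, T.dist z (f y) + t ≤ 4) (hγ : T.dist (f v) z ≤ t) :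
    ∀ x, x ∉ H → ∀ y ∈ H, T.dist (f x) (f y) = T.dist (f x) (f v) + t + T.dist z (f y) :=
  hO.dist_eq hH.toIsSplit z ht (fun y hy hvy => hα y (hH.mem_cliqueHull y hy hvy)) hγ

lemma dist_le_of_mem_cliqueHull {W : Type*} {T : SimpleGraph W} (f : G ↪g power T 4) {X : Set V}
    {x y : V} (hx : x ∈ X) (hy : y ∈ cliqueHull G X) : T.dist (f x) (f y) ≤ 4 := by
  by_cases hxy : x = y
  · simp [hxy]
  · exact dist_le_of_adj f (adj_of_mem_cliqueHull hx hy hxy)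

end Free

/-! ### Middle nodes and middle edges of longest paths. -/

section Middle

variable {V : Type u} {G : SimpleGraph V} {W : Type u} {T : SimpleGraph W}
  {f : G ↪g power T 4} {X : Set V}

/-- `c` lies on the path between `y₁` and `y₂`, so `p` reaches one of them through `c`. -/
lemma dist_add_min_le (hT : T.IsTree) {y₁ y₂ c p : W} {i j M : ℕ} (hi : T.dist c y₁ = i)
    (hj : T.dist c y₂ = j) (h : T.dist y₁ y₂ = i + j) (h₁ : T.dist p y₁ ≤ M)
    (h₂ : T.dist p y₂ ≤ M) : T.dist c p + min i j ≤ M := by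
  have hs := dist_swap T y₁ c
  have hs' := dist_swap T p c
  rcases dist_eq_or_dist_eq hT (y := y₁) (m := c) (w := y₂) (by omega) p with h | h <;> omega

/-- The vertices `x₁`, `x₂` of `X` have the maximum distance, which is `2 * k`, and `c` is the
middle node of the path between them. -/
structure HasMiddleNode (T : SimpleGraph W) (f : G ↪g power T 4) (X : Set V) (k : ℕ) (c : W)
    (x₁ x₂ : V) : Prop where
  left_mem : x₁ ∈ X
  right_mem : x₂ ∈ X
  dist_left : T.dist c (f x₁) = k
  dist_right : T.dist c (f x₂) = k
  dist_eq : T.dist (f x₁) (f x₂) = k + k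
  le : ∀ x ∈ X, ∀ y ∈ X, T.dist (f x) (f y) ≤ k + k

/-- The vertices `x₁`, `x₂` of `X` have the maximum distance, which is three, and `a`, `b` are the
internal nodes of the path between them. -/
structure HasMiddleEdge (T : SimpleGraph W) (f : G ↪g power T 4) (X : Set V) (a b : W)
    (x₁ x₂ : V) : Prop where
  left_mem : x₁ ∈ X
  right_mem : x₂ ∈ X
  adj : T.Adj a b
  dist_left_left : T.dist a (f x₁) = 1
  dist_left_right : T.dist a (f x₂) = 2
  dist_right_left : T.dist b (f x₁) = 2
  dist_right_right : T.dist b (f x₂) = 1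
  dist_eq : T.dist (f x₁) (f x₂) = 3
  le : ∀ x ∈ X, ∀ y ∈ X, T.dist (f x) (f y) ≤ 3

lemma HasMiddleEdge.symm {a b : W} {x₁ x₂ : V} (h : HasMiddleEdge T f X a b x₁ x₂) :
    HasMiddleEdge T f X b a x₂ x₁ :=
  ⟨h.right_mem, h.left_mem, h.adj.symm, h.dist_right_right, h.dist_right_left, h.dist_left_right,
    h.dist_left_left, by rw [dist_swap T, h.dist_eq], h.le⟩

lemma exists_middle [Finite V] (hT : T.IsTree) (hX : X ∈ cliqueIntersections G)
    (hne : X.Nonempty) :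
    (∃ k ≤ 2, ∃ c x₁ x₂, HasMiddleNode T f X k c x₁ x₂) ∨
    (∃ x₁ x₂, T.Adj (f x₁) (f x₂) ∧ X = {x₁, x₂}) ∨
    (∃ a b x₁ x₂, HasMiddleEdge T f X a b x₁ x₂) := by
  obtain ⟨⟨x₁, x₂⟩, ⟨h₁, h₂⟩, hmax⟩ := Set.exists_max_image (X ×ˢ X)
    (fun p => T.dist (f p.1) (f p.2)) (Set.toFinite _) (hne.prod hne)
  have hle : ∀ x ∈ X, ∀ y ∈ X, T.dist (f x) (f y) ≤ T.dist (f x₁) (f x₂) :=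
    fun x hx y hy => hmax (x, y) ⟨hx, hy⟩
  have h4 : T.dist (f x₁) (f x₂) ≤ 4 := dist_le_of_mem_cliqueHull f h₁ (subset_cliqueHull hX h₂)
  have heven : ∀ k, T.dist (f x₁) (f x₂) = k + k → ∃ c x₁ x₂, HasMiddleNode T f X k c x₁ x₂ := by
    intro k hk
    obtain ⟨c, hc, hc'⟩ := exists_dist_eq_of_le hT.connected (f x₁) (f x₂) k (by omega)
    exact ⟨c, x₁, x₂, h₁, h₂, by rw [dist_swap T, hc], by omega, hk, fun x hx y hy =>
      (hle x hx y hy).trans hk.le⟩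
  obtain h | h | h : (∃ k ≤ 2, T.dist (f x₁) (f x₂) = k + k) ∨ T.dist (f x₁) (f x₂) = 1 ∨
      T.dist (f x₁) (f x₂) = 3 := by
    generalize T.dist (f x₁) (f x₂) = n at h4
    interval_cases n
    · exact Or.inl ⟨0, by omega⟩
    · exact Or.inr (Or.inl rfl)
    · exact Or.inl ⟨1, by omega⟩
    · exact Or.inr (Or.inr rfl)
    · exact Or.inl ⟨2, by omega⟩
  · obtain ⟨k, hk, hk'⟩ := h
    exact Or.inl ⟨k, hk, heven k hk'⟩
  · have hadj := SimpleGraph.dist_eq_one_iff_adj.1 h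
    refine Or.inr (Or.inl ⟨x₁, x₂, hadj, Set.Subset.antisymm (fun x hx => ?_) ?_⟩)
    · rcases eq_or_eq_of_dist_le_one hT hadj (h ▸ hle x hx x₁ h₁) (h ▸ hle x hx x₂ h₂) with h' | h'
      · exact Or.inl (f.injective h')
      · exact Or.inr (f.injective h')
    · rintro x (rfl | rfl)
      · exact h₁
      · exact h₂
  · obtain ⟨a, ha, ha'⟩ := exists_dist_eq_of_le hT.connected (f x₁) (f x₂) 1 (by omega)
    have hne : a ≠ f x₂ := by
      rintro rfl
      rw [T.dist_self] at ha'
      omega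
    obtain ⟨b, hab, hb⟩ := exists_adj_dist_eq hT.connected hne
    have h1 := hT.connected.dist_triangle (u := f x₁) (v := b) (w := f x₂)
    have h2 := hT.connected.dist_triangle (u := f x₁) (v := a) (w := b)
    have h3 := SimpleGraph.dist_eq_one_iff_adj.2 hab
    have h4 := dist_swap T a (f x₁)
    have h5 := dist_swap T b (f x₁)
    exact Or.inr (Or.inr ⟨a, b, x₁, x₂, h₁, h₂, hab, by omega, by omega, by omega, by omega, h,
      fun x hx y hy => (hle x hx y hy).trans h.le⟩)

namespace HasMiddleNode

variable {k : ℕ} {c : W} {x₁ x₂ : V}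

lemma dist_le (hT : T.IsTree) (h : HasMiddleNode T f X k c x₁ x₂) {x : V} (hx : x ∈ X) :
    T.dist c (f x) ≤ k := by
  have := dist_add_min_le hT h.dist_left h.dist_right h.dist_eq (h.le x hx _ h.left_mem)
    (h.le x hx _ h.right_mem)
  omega

/-- A hull vertex is within four of both `x₁` and `x₂` and reaches one of them through `c`. This is
the room needed to reattach with `z = c` and `t = k`. -/
lemma dist_add_le (hT : T.IsTree) (h : HasMiddleNode T f X k c x₁ x₂) {y : V}
    (hy : y ∈ cliqueHull G X) : T.dist c (f y) + k ≤ 4 := by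
  have h1 := dist_le_of_mem_cliqueHull f h.left_mem hy
  have h2 := dist_le_of_mem_cliqueHull f h.right_mem hy
  rw [dist_swap T] at h1 h2
  have := dist_add_min_le hT h.dist_left h.dist_right h.dist_eq h1 h2
  omega

lemma subtreeCenter_eq (hT : T.IsTree) (h : HasMiddleNode T f X k c x₁ x₂) :
    subtreeCenter T (f '' X) = {c} := by
  refine subtreeCenter_eq_singleton hT (Set.mem_image_of_mem f h.left_mem)
    (Set.mem_image_of_mem f h.right_mem) h.dist_left h.dist_right h.dist_eq ?_
  rintro _ ⟨x, hx, rfl⟩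
  exact h.dist_le hT hx

lemma dist_eq_of_isSide [Fintype V] [Finite W] {r : V} (hO : IsOptimal r T f)
    (h : HasMiddleNode T f X k c x₁ x₂) (hk : 1 ≤ k) {v : V} (hv : v ∈ X) {H : Set V}
    (hH : IsSide G X v H) :
    ∀ x, x ∉ H → ∀ y ∈ H, T.dist (f x) (f y) = T.dist (f x) (f v) + k + T.dist c (f y) :=
  hO.dist_eq_of_isSide hH c hk (fun _ hy => h.dist_add_le hO.isTree hy)
    (by rw [dist_swap T]; exact h.dist_le hO.isTree hv)

end HasMiddleNode

namespace HasMiddleEdge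

variable {a b : W} {x₁ x₂ : V}

lemma dist_left_le (hT : T.IsTree) (h : HasMiddleEdge T f X a b x₁ x₂) {x : V} (hx : x ∈ X) :
    T.dist a (f x) ≤ 2 := by
  have := dist_add_min_le hT h.dist_left_left h.dist_left_right h.dist_eq
    (h.le x hx _ h.left_mem) (h.le x hx _ h.right_mem)
  omega

lemma dist_left_le_three (hT : T.IsTree) (h : HasMiddleEdge T f X a b x₁ x₂) {y : V}
    (hy : y ∈ cliqueHull G X) : T.dist a (f y) ≤ 3 := by
  have h1 := dist_le_of_mem_cliqueHull f h.left_mem hy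
  have h2 := dist_le_of_mem_cliqueHull f h.right_mem hy
  rw [dist_swap T] at h1 h2
  have := dist_add_min_le hT h.dist_left_left h.dist_left_right h.dist_eq h1 h2
  omega

lemma subtreeCenter_eq (hT : T.IsTree) (h : HasMiddleEdge T f X a b x₁ x₂) :
    subtreeCenter T (f '' X) = {a, b} := by
  refine subtreeCenter_eq_pair hT (k := 1) (Set.mem_image_of_mem f h.left_mem)
    (Set.mem_image_of_mem f h.right_mem) h.adj h.dist_left_left h.dist_left_right
    h.dist_right_left h.dist_right_right h.dist_eq ?_ ?_
  · rintro _ ⟨x, hx, rfl⟩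
    exact h.dist_left_le hT hx
  · rintro _ ⟨x, hx, rfl⟩
    exact h.symm.dist_left_le hT hx

lemma dist_eq_of_dist_le_one [Fintype V] [Finite W] {r : V} (hO : IsOptimal r T f)
    (h : HasMiddleEdge T f X a b x₁ x₂) {v : V} (hv : T.dist a (f v) ≤ 1) {H : Set V}
    (hH : IsSide G X v H) :
    ∀ x, x ∉ H → ∀ y ∈ H, T.dist (f x) (f y) = T.dist (f x) (f v) + 1 + T.dist a (f y) :=
  hO.dist_eq_of_isSide hH a le_rfl
    (fun y hy => by have := h.dist_left_le_three hO.isTree hy; omega)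
    (by rwa [dist_swap T])

/-- A free vertex placed at `a` could have its side pushed one step away. -/
lemma one_le_dist_left [Fintype V] [Finite W] {r : V} (hO : IsOptimal r T f)
    (h : HasMiddleEdge T f X a b x₁ x₂) (hX : X ∈ cliqueIntersections G) {v : V} {H : Set V}
    (hH : IsSide G X v H) : 1 ≤ T.dist a (f v) := by
  by_contra hlt
  have hx₂ : x₂ ∈ H := by
    refine hH.mem_of_mem_cliqueHull x₂ (subset_cliqueHull hX h.right_mem) ?_
    rintro rfl
    have := h.dist_left_right
    omega
  have h1 := h.dist_eq_of_dist_le_one hO (by omega) hH v hH.notMem x₂ hx₂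
  have h2 := hO.isTree.connected.dist_triangle (u := f v) (v := a) (w := f x₂)
  rw [T.dist_self] at h1
  rw [dist_swap T a (f v)] at hlt
  omega

/-- A free vertex is a neighbour of exactly one of the two middle nodes. -/
lemma dist_eq_one_or_dist_eq_one [Fintype V] [Finite W] {r : V} (hO : IsOptimal r T f)
    (h : HasMiddleEdge T f X a b x₁ x₂) (hX : X ∈ cliqueIntersections G) {v : V} (hv : v ∈ X)
    {H : Set V} (hH : IsSide G X v H) :
    T.dist a (f v) = 1 ∧ T.dist b (f v) = 2 ∨ T.dist a (f v) = 2 ∧ T.dist b (f v) = 1 := by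
  have h1 := h.one_le_dist_left hO hX hH
  have h2 := h.symm.one_le_dist_left hO hX hH
  have h3 := h.dist_left_le hO.isTree hv
  have h4 := h.symm.dist_left_le hO.isTree hv
  have h5 := hO.isTree.dist_ne_of_adj (f v) h.adj
  rw [dist_swap T _ a, dist_swap T _ b] at h5
  omega

/-- Free vertices at `a` and `b` cannot both occur twice if one of them may be moved from `a`
to `b` so that the score grows. -/
lemma false_of_two_of_two [Fintype V] [Finite W] {r : V} (hO : IsOptimal r T f)
    (h : HasMiddleEdge T f X a b x₁ x₂) (hX : X ∈ cliqueIntersections G)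
    (hab : b ∈ Set.range f → a ∈ Set.range f)
    (hlt : (a ∈ Set.range f ∧ b ∉ Set.range f) ∨ T.dist a (f r) < T.dist b (f r))
    {v v' w w' : V} (hv : v ∈ X) (hv' : v' ∈ X) (hw : w ∈ X) (hw' : w' ∈ X) (hvv : v ≠ v')
    (hww : w ≠ w') (hav : T.dist a (f v) = 1) (hav' : T.dist a (f v') = 1)
    (hbw : T.dist b (f w) = 1) (hbw' : T.dist b (f w') = 1) {H Hw Hw' : Set V}
    (hH : IsSide G X v H) (hHw : IsSide G X w Hw) (hHw' : IsSide G X w' Hw') (hr : r ∈ H) :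
    False := by
  have hT := hO.isTree
  have Fv := h.dist_eq_of_dist_le_one hO hav.le hH
  have Fw := h.symm.dist_eq_of_dist_le_one hO hbw.le hHw
  have Fw' := h.symm.dist_eq_of_dist_le_one hO hbw'.le hHw'
  have hbv := h.symm.one_le_dist_left hO hX hH
  have hv'H : v' ∈ H := hH.mem_of_mem_cliqueHull v' (subset_cliqueHull hX hv') hvv.symm
  have hw'Hw : w' ∈ Hw := hHw.mem_of_mem_cliqueHull w' (subset_cliqueHull hX hw') hww.symm
  have hwHw' : w ∈ Hw' := hHw'.mem_of_mem_cliqueHull w (subset_cliqueHull hX hw) hww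
  -- The second free vertex at `a` matters here: `v'` is in `H`, so `p` is not adjacent to it, while
  -- `dist(p, v') = dist(p, v) + 2`.
  have far : ∀ p, p ∉ H → p ≠ v → 3 ≤ T.dist (f p) (f v) := by
    intro p hp hpv
    have h1 := hH.not_adj p hp hpv v' hv'H
    rw [adj_iff_dist_le hT f (by rintro rfl; exact hp hv'H), Fv p hp v' hv'H, hav'] at h1
    omega
  have hroot : IsRootDist G
      (cutDist (fun x y => T.dist (f x) (f y)) v H 1 (fun y => T.dist b (f y))) := by
    refine isRootDist_cutDist hT f hH.toIsSplit b le_rfl (fun y hy => ⟨fun hvy => ?_,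
      fun hle => ?_⟩) (fun p hp hpv y hy => ?_)
    · have := h.symm.dist_left_le_three hT (hH.mem_cliqueHull y hy hvy)
      omega
    · by_contra hvy
      have hne : v ≠ y := by
        rintro rfl
        exact hH.notMem hy
      have hyX : y ∉ cliqueHull G X := fun h => hvy (adj_of_mem_cliqueHull hv h hne)
      -- The two free vertices at `b` matter here: a nonneighbour `y` of `v` within three of `b`
      -- would lie outside both their sides, making each of `dist(y, w)` and `dist(y, w')` exceed
      -- the other by two.
      have side : ∀ {u : V} {K : Set V}, u ∈ X → IsSide G X u K →
          (∀ x, x ∉ K → ∀ y ∈ K, T.dist (f x) (f y) = T.dist (f x) (f u) + 1 + T.dist b (f y)) →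
          y ∉ K := by
        intro u K hu hK hF hyK
        have hne : u ≠ y := by
          rintro rfl
          exact hK.notMem hyK
        have h1 := hF u hK.notMem y hyK
        rw [T.dist_self] at h1
        exact hyX (hK.mem_cliqueHull y hyK ((adj_iff_dist_le hT f hne).2 (by omega)))
      have h1 := Fw y (side hw hHw Fw) w' hw'Hw
      have h2 := Fw' y (side hw' hHw' Fw') w hwHw'
      omega
    · have h1 := far p hp hpv
      -- The bound three from `far` is one short only if `y` sits at `b`. Then `a` also carries a
      -- vertex, and it lies in `H`; its nonadjacency to `p` raises the bound to four.
      by_cases hby : T.dist b (f y) = 0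
      · have hby' := hT.connected.dist_eq_zero_iff.1 hby
        obtain ⟨q, rfl⟩ := hab ⟨y, hby'.symm⟩
        have hqv : q ≠ v := by
          rintro rfl
          rw [T.dist_self] at hav
          omega
        have hqH : q ∈ H := by
          by_contra hqH
          have := Fv q hqH v' hv'H
          omega
        have h2 := hH.not_adj p hp hpv q hqH
        rw [adj_iff_dist_le hT f (by rintro rfl; exact hp hqH), Fv p hp q hqH, T.dist_self] at h2
        omega
      · omega
  -- A new pair at distance one can only be `v` and a vertex at `b`. Neither was isolated: `w` is
  -- next to `b`, and `v` is next to the vertex at `a` supplied by `hab`.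
  have hiso : ∀ p, IsIsolated (fun x y => T.dist (f x) (f y)) p → IsIsolated
      (cutDist (fun x y => T.dist (f x) (f y)) v H 1 (fun y => T.dist b (f y))) p := by
    intro p hp y hyp
    have hpy := hp y hyp
    dsimp only at hpy
    unfold cutDist
    split_ifs with h1 h2 h2
    · exact hpy
    · by_contra hcon
      dsimp only at hcon
      have hb : f p = b := (hT.connected.dist_eq_zero_iff.1 (by omega : T.dist b (f p) = 0)).symm
      have hwp : w ≠ p := by
        rintro rfl
        rw [hb, T.dist_self] at hbw
        omega
      have := hp w hwp
      dsimp only at this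
      rw [hb, hbw] at this
      omega
    · by_contra hcon
      dsimp only at hcon
      have hb : f y = b := (hT.connected.dist_eq_zero_iff.1 (by omega : T.dist b (f y) = 0)).symm
      have hpv : p = v := f.injective
        (hT.connected.dist_eq_zero_iff.1 (by omega : T.dist (f p) (f v) = 0))
      obtain ⟨q, rfl⟩ := hab ⟨y, hb⟩
      have hqp : q ≠ p := by
        rintro rfl
        rw [hpv, T.dist_self] at hav
        omega
      have := hp q hqp
      dsimp only at this
      rw [hpv, dist_swap T, hav] at this
      omega
    · exact hpy
  refine hO.not_score_lt _ hroot ?_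
  -- Either `v` leaves a vertex at `a` for an unoccupied `b` and becomes isolated, or all vertices
  -- outside `H` move away from `r`.
  rcases hlt with ⟨⟨q, rfl⟩, hb⟩ | hlt
  · have hqv : q ≠ v := by
      rintro rfl
      rw [T.dist_self] at hav
      omega
    refine score_lt_of_isIsolated r hiso (x := v) (fun hcon => ?_) (fun y hy => ?_)
    · have := hcon q hqv
      dsimp only at this
      rw [dist_swap T, hav] at this
      omega
    · unfold cutDist
      rw [if_neg hH.notMem]
      split_ifs with h1
      · have := hT.connected.pos_dist_of_ne (fun hby : b = f y => hb ⟨y, hby.symm⟩)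
        dsimp only
        omega
      · have := far y h1 hy
        rw [dist_swap T] at this
        dsimp only
        omega
  · refine score_lt_of_sum hiso (Finset.sum_lt_sum (fun y _ => ?_) ⟨v, Finset.mem_univ v, ?_⟩)
    · unfold cutDist
      rw [if_pos hr]
      split_ifs with h1
      · exact le_rfl
      · have := Fv y h1 r hr
        dsimp only
        rw [dist_swap T (f r), dist_swap T (f v)]
        omega
    · unfold cutDist
      rw [if_pos hr, if_neg hH.notMem]
      have := Fv v hH.notMem r hr
      dsimp only
      rw [dist_swap T (f r)]
      rw [T.dist_self] at this ⊢
      omega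

/-- The direction of the move: if exactly one of `a`, `b` carries a vertex, away from that one;
otherwise from the end nearer to `r` to the farther, the two distances being different by parity. -/
lemma exists_subsingleton [Fintype V] [Finite W] {r : V} (hO : IsOptimal r T f)
    (h : HasMiddleEdge T f X a b x₁ x₂) (hX : X ∈ cliqueIntersections G) :
    {v | IsFree G X v ∧ T.dist a (f v) = 1}.Subsingleton ∨
      {v | IsFree G X v ∧ T.dist b (f v) = 1}.Subsingleton := by
  have hT := hO.isTree
  by_contra! hcon
  obtain ⟨⟨v, ⟨hv, hav⟩, v', ⟨hv', hav'⟩, hvv⟩, w, ⟨hw, hbw⟩, w', ⟨hw', hbw'⟩, hww⟩ := hcon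
  have main : ∀ {a b : W} {x₁ x₂ : V}, HasMiddleEdge T f X a b x₁ x₂ →
      (b ∈ Set.range f → a ∈ Set.range f) →
      ((a ∈ Set.range f ∧ b ∉ Set.range f) ∨ T.dist a (f r) < T.dist b (f r)) →
      ∀ {v v' w w' : V}, IsFree G X v → IsFree G X v' → IsFree G X w → IsFree G X w' →
      v ≠ v' → w ≠ w' → T.dist a (f v) = 1 → T.dist a (f v') = 1 → T.dist b (f w) = 1 →
      T.dist b (f w') = 1 → False := by
    intro a b x₁ x₂ h hab hlt v v' w w' hv hv' hw hw' hvv hww hav hav' hbw hbw'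
    obtain ⟨H, hH⟩ := hv.exists_isSide hT f hX
    obtain ⟨H', hH'⟩ := hv'.exists_isSide hT f hX
    obtain ⟨K, hK⟩ := hw.exists_isSide hT f hX
    obtain ⟨K', hK'⟩ := hw'.exists_isSide hT f hX
    by_cases hr : r ∈ H
    · exact h.false_of_two_of_two hO hX hab hlt hv.1 hv'.1 hw.1 hw'.1 hvv hww hav hav' hbw hbw'
        hH hK hK' hr
    by_cases hr' : r ∈ H'
    · exact h.false_of_two_of_two hO hX hab hlt hv'.1 hv.1 hw.1 hw'.1 hvv.symm hww hav' hav hbw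
        hbw' hH' hK hK' hr'
    -- If `r` avoided both sides, `v` and `v'` would each be two further from `r` than the other.
    have h1 := h.dist_eq_of_dist_le_one hO hav.le hH r hr v'
      (hH.mem_of_mem_cliqueHull v' (subset_cliqueHull hX hv'.1) hvv.symm)
    have h2 := h.dist_eq_of_dist_le_one hO hav'.le hH' r hr' v
      (hH'.mem_of_mem_cliqueHull v (subset_cliqueHull hX hv.1) hvv)
    omega
  have hne := hT.dist_ne_of_adj (f r) h.adj
  rw [dist_swap T _ a, dist_swap T _ b] at hne
  by_cases hba : b ∈ Set.range f → a ∈ Set.range f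
  · by_cases hab : a ∈ Set.range f → b ∈ Set.range f
    · rcases hne.lt_or_gt with hlt | hlt
      · exact main h hba (Or.inr hlt) hv hv' hw hw' hvv hww hav hav' hbw hbw'
      · exact main h.symm hab (Or.inr hlt) hw hw' hv hv' hww hvv hbw hbw' hav hav'
    · rw [Classical.not_imp] at hab
      exact main h hba (Or.inl hab) hv hv' hw hw' hvv hww hav hav' hbw hbw'
  · rw [Classical.not_imp] at hba
    exact main h.symm (fun h => absurd h hba.2) (Or.inl hba) hw hw' hv hv' hww hvv hbw hbw' hav
      hav'

end HasMiddleEdge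

end Middle

/-! ### The four properties of an optimal root. -/

section WellStructured

variable {V : Type u} {G : SimpleGraph V} {W : Type u} {T : SimpleGraph W}
  {f : G ↪g power T 4} {X : Set V}

lemma dist_eq_of_mem_support (hT : T.IsTree) {x y w : W} {p : T.Walk x y} (hp : p.IsPath)
    (hw : w ∈ p.support) : T.dist x y = T.dist x w + T.dist w y := by
  classical
  obtain ⟨q, hq, hql⟩ := hT.connected.exists_path_of_dist x y
  obtain rfl := (hT.existsUnique_path x y).unique hp hq
  have h1 := T.dist_le (p.takeUntil w hw)
  have h2 := T.dist_le (p.dropUntil w hw)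
  have h3 := congrArg SimpleGraph.Walk.length (p.take_spec hw)
  rw [SimpleGraph.Walk.length_append] at h3
  have := hT.connected.dist_triangle (u := x) (v := w) (w := y)
  omega

lemma mem_support_of_dist_eq (hT : T.IsTree) {x y w : W} {p : T.Walk x y} (hp : p.IsPath)
    (hw : T.dist x y = T.dist x w + T.dist w y) : w ∈ p.support := by
  obtain ⟨p₁, h₁⟩ := hT.connected.exists_walk_length_eq_dist x w
  obtain ⟨p₂, h₂⟩ := hT.connected.exists_walk_length_eq_dist w y
  have hpath : (p₁.append p₂).IsPath := by
    apply SimpleGraph.Walk.isPath_of_length_eq_dist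
    rw [SimpleGraph.Walk.length_append]
    omega
  rw [(hT.existsUnique_path x y).unique hp hpath]
  simp

/-- A vertex all of whose shortest paths to the vertices of `X` start with the same edge is a leaf
of `T⟨X⟩`. -/
lemma isLeaf_of_forall_dist_eq (hT : T.IsTree) {v u u' : V} {s : W} {ℓ : ℕ} (hv : v ∈ X)
    (hu : u ∈ X) (huv : u ≠ v) (hadj : T.Adj (f v) s)
    (hs : ∀ y ∈ X, y ≠ v → T.dist (f v) (f y) = T.dist s (f y) + 1)
    (hle : ∀ x ∈ X, ∀ y ∈ X, T.dist (f x) (f y) ≤ ℓ) (hu' : u' ∈ X)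
    (hℓ : T.dist (f v) (f u') = ℓ) :
    ∃ h : f v ∈ subtreeNodes T (f '' X),
      ((subtree T (f '' X)).neighborSet ⟨f v, h⟩).encard = 1 ∧
      (subtree T (f '' X)).eccent ⟨f v, h⟩ = (subtree T (f '' X)).ediam := by
  have hvX := Set.mem_image_of_mem f hv
  have hle' : ∀ x ∈ f '' X, ∀ y ∈ f '' X, T.dist x y ≤ ℓ := by
    rintro _ ⟨x, hx, rfl⟩ _ ⟨y, hy, rfl⟩
    exact hle x hx y hy
  have h1 := SimpleGraph.dist_eq_one_iff_adj.2 hadj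
  refine ⟨subset_subtreeNodes _ hvX, ?_, ?_⟩
  · have hsN : s ∈ subtreeNodes T (f '' X) := (mem_subtreeNodes_iff hT hvX s).2
      ⟨f u, Set.mem_image_of_mem f hu, by rw [hs u hu huv, h1, Nat.add_comm]⟩
    rw [Set.encard_eq_one]
    refine ⟨⟨s, hsN⟩, Set.Subset.antisymm ?_ ?_⟩
    · rintro ⟨q, hq⟩ hvq
      have hvq' : T.Adj (f v) q := hvq
      have h2 := SimpleGraph.dist_eq_one_iff_adj.2 hvq'
      obtain ⟨_, ⟨y, hy, rfl⟩, hy'⟩ := (mem_subtreeNodes_iff hT hvX q).1 hq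
      have hyv : y ≠ v := by
        rintro rfl
        rw [T.dist_self] at hy'
        omega
      have hqs : q = s := eq_of_adj_of_dist_eq hT hvq' hadj (by omega) (hs y hy hyv)
      exact Subtype.ext hqs
    · rintro _ rfl
      exact hadj
  · rw [ediam_subtree_eq hT hle' hvX (Set.mem_image_of_mem f hu') hℓ]
    apply le_antisymm
    · exact (eccent_subtree_le_iff hT ⟨_, hvX⟩ _ ℓ).2 fun x hx => hle' _ hvX x hx
    · rw [← hℓ]
      exact le_eccent_subtree hT _ (Set.mem_image_of_mem f hu')

/-- The first step from `v` towards a node `c` through which `v` reaches the vertices of `X`. -/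
lemma exists_adj_of_forall_dist_eq (hT : T.IsTree) {v : V} {c : W} {t : ℕ} (ht : 1 ≤ t)
    (hc : T.dist (f v) c ≤ t)
    (h : ∀ y ∈ X, y ≠ v → T.dist (f v) (f y) = t + T.dist c (f y)) {u : V} (hu : u ∈ X)
    (huv : u ≠ v) :
    ∃ s, T.Adj (f v) s ∧ ∀ y ∈ X, y ≠ v → T.dist (f v) (f y) = T.dist s (f y) + 1 := by
  have h1 := h u hu huv
  have h2 := hT.connected.dist_triangle (u := f v) (v := c) (w := f u)
  have hne : f v ≠ c := by
    rintro rfl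
    omega
  obtain ⟨s, hadj, hs⟩ := exists_adj_dist_eq hT.connected hne
  refine ⟨s, hadj, fun y hy hyv => ?_⟩
  have h3 := SimpleGraph.dist_eq_one_iff_adj.2 hadj
  have h4 := h y hy hyv
  have h5 := hT.connected.dist_triangle (u := f v) (v := s) (w := f y)
  have h6 := hT.connected.dist_triangle (u := s) (v := c) (w := f y)
  omega

lemma eq_or_eq_of_pair {x₁ x₂ v u : V} (hX : X = {x₁, x₂}) (hv : v ∈ X) (hu : u ∈ X)
    (huv : u ≠ v) : v = x₁ ∧ u = x₂ ∨ v = x₂ ∧ u = x₁ := by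
  subst hX
  rcases hv with rfl | rfl <;> rcases hu with rfl | rfl <;> simp_all

lemma subtreeCenter_image_pair (hT : T.IsTree) {x₁ x₂ : V} (hadj : T.Adj (f x₁) (f x₂)) :
    subtreeCenter T (f '' {x₁, x₂}) = {f x₁, f x₂} := by
  have h1 := SimpleGraph.dist_eq_one_iff_adj.2 hadj
  have h2 : T.dist (f x₂) (f x₁) = 1 := by rw [dist_swap T, h1]
  refine subtreeCenter_eq_pair hT (k := 0) (x₁ := f x₁) (x₂ := f x₂) (by simp) (by simp)
    hadj (by simp) h1 h2 (by simp) h1 ?_ ?_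
  · rintro _ ⟨x, rfl | rfl, rfl⟩
    · simp
    · exact h1.le
  · rintro _ ⟨x, rfl | rfl, rfl⟩
    · exact h2.le
    · simp

variable [Fintype V] [Finite W] {r : V}

lemma IsOptimal.grouped (hO : IsOptimal r T f) (hX : X ∈ cliqueIntersections G)
    (hne : X.Nonempty) : ∃ c ∈ subtreeCenter T (f '' X), {v | IsFree G X v ∧
      T.dist (f v) c ≠ distToSet T (f v) (subtreeCenter T (f '' X))}.Subsingleton := by
  have hT := hO.isTree
  rcases exists_middle (f := f) hT hX hne with
    ⟨k, hk, c, x₁, x₂, h⟩ | ⟨x₁, x₂, hadj, hXp⟩ | ⟨a, b, x₁, x₂, h⟩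
  · rw [h.subtreeCenter_eq hT]
    refine ⟨c, rfl, fun v hv => absurd ?_ hv.2⟩
    simp [distToSet]
  · have h1 := SimpleGraph.dist_eq_one_iff_adj.2 hadj
    have hcenter : subtreeCenter T (f '' X) = {f x₁, f x₂} := by
      rw [hXp, subtreeCenter_image_pair hT hadj]
    rw [hcenter]
    refine ⟨f x₁, by simp, ?_⟩
    have hsub : ∀ v, (IsFree G X v ∧ T.dist (f v) (f x₁) ≠ distToSet T (f v) {f x₁, f x₂}) →
        v = x₂ := by
      rintro v ⟨hv, hne⟩
      have hvX := hv.1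
      rw [hXp] at hvX
      rcases hvX with rfl | rfl
      · refine absurd ?_ hne
        rw [T.dist_self, eq_comm, ← Nat.le_zero]
        exact Nat.sInf_le ⟨f v, by simp, by simp⟩
      · rfl
    intro v hv w hw
    rw [hsub v hv, hsub w hw]
  · have main : ∀ {a b : W} {x₁ x₂ : V}, HasMiddleEdge T f X a b x₁ x₂ →
        {v | IsFree G X v ∧ T.dist b (f v) = 1}.Subsingleton →
        ∃ c ∈ subtreeCenter T (f '' X), {v | IsFree G X v ∧
          T.dist (f v) c ≠ distToSet T (f v) (subtreeCenter T (f '' X))}.Subsingleton := by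
      intro a b x₁ x₂ h hs
      rw [h.subtreeCenter_eq hT]
      refine ⟨a, by simp, hs.anti ?_⟩
      rintro v ⟨hv, hne⟩
      refine ⟨hv, ?_⟩
      obtain ⟨H, hH⟩ := hv.exists_isSide hT f hX
      rcases h.dist_eq_one_or_dist_eq_one hO hX hv.1 hH with h' | h'
      · refine absurd ?_ hne
        simp [distToSet, Set.image_pair, dist_swap T (f v), h'.1, h'.2]
      · exact h'.2
    rcases h.exists_subsingleton hO hX with hs | hs
    · exact main h.symm hs
    · exact main h hs

variable [Nontrivial V]

/-- By rigidity all paths from `v` to the rest of `X` start with the same edge, and `v` is as far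
from an end of a longest path as the other end is. -/
lemma IsOptimal.leaf (hO : IsOptimal r T f) (hG : G.Connected) (hX : X ∈ cliqueIntersections G)
    {v : V} (hv : IsFree G X v) :
    ∃ h : f v ∈ subtreeNodes T (f '' X),
      ((subtree T (f '' X)).neighborSet ⟨f v, h⟩).encard = 1 ∧
      (subtree T (f '' X)).eccent ⟨f v, h⟩ = (subtree T (f '' X)).ediam := by
  have hT := hO.isTree
  obtain ⟨u, hu, huv⟩ := exists_ne_of_isFree hG hv
  obtain ⟨H, hH⟩ := hv.exists_isSide hT f hX
  have hXH : ∀ y ∈ X, y ≠ v → y ∈ H :=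
    fun y hy => hH.mem_of_mem_cliqueHull y (subset_cliqueHull hX hy)
  rcases exists_middle (f := f) hT hX ⟨u, hu⟩ with
    ⟨k, hk, c, x₁, x₂, h⟩ | ⟨x₁, x₂, hadj, hXp⟩ | ⟨a, b, x₁, x₂, h⟩
  · have hk1 : 1 ≤ k := by
      have h1 := h.le u hu v hv.1
      have h2 := hT.connected.pos_dist_of_ne (f.injective.ne huv)
      omega
    have F : ∀ y ∈ X, y ≠ v → T.dist (f v) (f y) = k + T.dist c (f y) := by
      intro y hy hyv
      rw [h.dist_eq_of_isSide hO hk1 hv.1 hH v hH.notMem y (hXH y hy hyv), T.dist_self,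
        Nat.zero_add]
    obtain ⟨s, hs, hs'⟩ := exists_adj_of_forall_dist_eq hT hk1
      (by rw [dist_swap T]; exact h.dist_le hT hv.1) F hu huv
    by_cases hx : x₁ = v
    · have hx₂ : x₂ ≠ v := by
        rintro rfl
        have := h.dist_eq
        rw [hx, T.dist_self] at this
        omega
      exact isLeaf_of_forall_dist_eq hT hv.1 hu huv hs hs' h.le h.right_mem
        (by rw [F x₂ h.right_mem hx₂, h.dist_right])
    · exact isLeaf_of_forall_dist_eq hT hv.1 hu huv hs hs' h.le h.left_mem
        (by rw [F x₁ h.left_mem hx, h.dist_left])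
  · have hvu : T.Adj (f v) (f u) := by
      rcases eq_or_eq_of_pair hXp hv.1 hu huv with ⟨rfl, rfl⟩ | ⟨rfl, rfl⟩
      · exact hadj
      · exact hadj.symm
    have hX2 : ∀ y ∈ X, y ≠ v → y = u := by
      intro y hy hyv
      rcases eq_or_eq_of_pair hXp hv.1 hu huv with ⟨rfl, rfl⟩ | ⟨rfl, rfl⟩ <;>
        rcases eq_or_eq_of_pair hXp hv.1 hy hyv with ⟨_, h⟩ | ⟨_, h⟩ <;> simp_all
    have h1 := SimpleGraph.dist_eq_one_iff_adj.2 hvu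
    refine isLeaf_of_forall_dist_eq hT (ℓ := 1) hv.1 hu huv hvu (fun y hy hyv => ?_)
      (fun x hx y hy => ?_) hu h1
    · rw [hX2 y hy hyv, h1, T.dist_self]
    · by_cases hxv : x = v <;> by_cases hyv : y = v
      · simp [hxv, hyv]
      · rw [hxv, hX2 y hy hyv, h1]
      · rw [hyv, hX2 x hx hxv, dist_swap T, h1]
      · simp [hX2 x hx hxv, hX2 y hy hyv]
  · have main : ∀ {a b : W} {x₁ x₂ : V}, HasMiddleEdge T f X a b x₁ x₂ → T.dist a (f v) = 1 →
        ∃ h : f v ∈ subtreeNodes T (f '' X),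
          ((subtree T (f '' X)).neighborSet ⟨f v, h⟩).encard = 1 ∧
          (subtree T (f '' X)).eccent ⟨f v, h⟩ = (subtree T (f '' X)).ediam := by
      intro a b x₁ x₂ h hav
      have F : ∀ y ∈ X, y ≠ v → T.dist (f v) (f y) = 1 + T.dist a (f y) := by
        intro y hy hyv
        rw [h.dist_eq_of_dist_le_one hO hav.le hH v hH.notMem y (hXH y hy hyv), T.dist_self,
          Nat.zero_add]
      obtain ⟨s, hs, hs'⟩ := exists_adj_of_forall_dist_eq hT le_rfl
        (by rw [dist_swap T, hav]) F hu huv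
      have hx₂ : x₂ ≠ v := by
        rintro rfl
        have := h.dist_left_right
        omega
      exact isLeaf_of_forall_dist_eq hT hv.1 hu huv hs hs' h.le h.right_mem
        (by rw [F x₂ h.right_mem hx₂, h.dist_left_right])
    rcases h.dist_eq_one_or_dist_eq_one hO hX hv.1 hH with h' | h'
    · exact main h h'.1
    · exact main h.symm h'.2

/-- The node between the center of `T⟨X⟩` and an `X`-free vertex, if `T⟨X⟩` has diameter four. -/
lemma IsOptimal.notMem_range_and_encard_eq_two (hO : IsOptimal r T f) (hG : G.Connected)
    (hX : X ∈ cliqueIntersections G) {v x₁ x₂ : V} {c : W} (hv : IsFree G X v)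
    (h : HasMiddleNode T f X 2 c x₁ x₂) {w : W} (hcw : T.dist c w = 1)
    (hwv : T.dist w (f v) = 1) : w ∉ Set.range f ∧ (T.neighborSet w).encard = 2 := by
  have hT := hO.isTree
  obtain ⟨u, hu, huv⟩ := exists_ne_of_isFree hG hv
  obtain ⟨H, hH⟩ := hv.exists_isSide hT f hX
  have huH := hH.mem_of_mem_cliqueHull u (subset_cliqueHull hX hu) huv
  have F := h.dist_eq_of_isSide hO (by omega) hv.1 hH
  have hcv : T.dist c (f v) ≤ 2 := h.dist_le hT hv.1
  have hcv' : T.dist (f v) c = 2 := by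
    have h1 := F v hH.notMem u huH
    have h2 := hT.connected.dist_triangle (u := f v) (v := c) (w := f u)
    rw [T.dist_self] at h1
    rw [dist_swap T] at hcv
    omega
  -- No vertex hangs off the path at `w`: in `H` it would have to be reached from `v` through `c`,
  -- and outside `H` it would have to reach `u` through `v`, although `w` offers a shortcut in both
  -- cases.
  have key : ∀ x, T.dist (f v) (f x) = 1 + T.dist w (f x) →
      T.dist c (f x) = 1 + T.dist w (f x) → False := by
    intro x hvx hcx
    by_cases hxH : x ∈ H
    · have h1 := F v hH.notMem x hxH
      rw [T.dist_self] at h1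
      omega
    · have h1 := F x hxH u huH
      have h2 := hT.connected.dist_triangle (u := f x) (v := w) (w := f u)
      have h3 := hT.connected.dist_triangle (u := w) (v := c) (w := f u)
      have h4 := dist_swap T (f x) (f v)
      have h5 := dist_swap T (f x) w
      have h6 := dist_swap T w c
      omega
  refine ⟨?_, ?_⟩
  · rintro ⟨x, rfl⟩
    refine key x ?_ ?_
    · rw [dist_swap T, hwv, T.dist_self]
    · rw [hcw, T.dist_self]
  · have hcne : c ≠ f v := by
      rintro rfl
      rw [T.dist_self] at hcv'
      omega
    have hwc : T.Adj w c := (SimpleGraph.dist_eq_one_iff_adj.1 hcw).symm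
    have hwv' : T.Adj w (f v) := SimpleGraph.dist_eq_one_iff_adj.1 hwv
    have : T.neighborSet w = {c, f v} := by
      refine Set.Subset.antisymm (fun q hq => ?_) ?_
      · by_contra hcon
        have hqc : q ≠ c := fun h => hcon (by simp [h])
        have hqv : q ≠ f v := fun h => hcon (by simp [h])
        have hwq : T.Adj w q := hq
        have dwq := SimpleGraph.dist_eq_one_iff_adj.2 hwq
        have two : ∀ z, T.Adj w z → q ≠ z → T.dist z q = T.dist z w + T.dist w q := by
          intro z hz hqz
          have h1 := SimpleGraph.dist_eq_one_iff_adj.2 hz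
          have h2 := hT.connected.dist_triangle (u := z) (v := w) (w := q)
          have h3 := hT.connected.pos_dist_of_ne hqz.symm
          have h4 := hT.dist_ne_of_adj z hwq
          rw [dist_swap T z w] at h2 h4 ⊢
          omega
        -- Pruning matters here: a third neighbour `q` of `w` leads to some vertex `x`,
        -- contradicting `key`.
        obtain ⟨x, hx⟩ := hO.span v q
        have hwx : T.dist w (f x) = T.dist q (f x) + 1 := by
          have h1 := two (f v) hwv' hqv
          have h2 := hT.connected.dist_triangle (u := f v) (v := w) (w := f x)
          have h3 := hT.connected.dist_triangle (u := w) (v := q) (w := f x)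
          omega
        have through : ∀ z, T.Adj w z → q ≠ z → T.dist z (f x) = 1 + T.dist w (f x) := by
          intro z hz hqz
          have h1 := SimpleGraph.dist_eq_one_iff_adj.2 hz
          rcases dist_eq_or_dist_eq hT (two z hz hqz) (f x) with h2 | h2
          · rw [dist_swap T z, h2, h1, dist_swap T w]
            omega
          · rw [dist_swap T (f x) q, dist_swap T (f x) w] at h2
            omega
        exact key x (through (f v) hwv' hqv) (through c hwc hqc)
      · rintro _ (rfl | rfl)
        · exact hwc
        · exact hwv'
    rw [this, Set.encard_pair hcne]

lemma IsOptimal.internal (hO : IsOptimal r T f) (hG : G.Connected)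
    (hX : X ∈ cliqueIntersections G) {v : V} (hv : IsFree G X v) {c : W}
    (hc : c ∈ subtreeCenter T (f '' X)) {p : T.Walk c (f v)} (hp : p.IsPath)
    (hpc : ∀ w ∈ p.support, w ∈ subtreeCenter T (f '' X) → w = c) {w : W} (hw : w ∈ p.support)
    (hwc : w ≠ c) (hwv : w ≠ f v) : w ∉ Set.range f ∧ (T.neighborSet w).encard = 2 := by
  have hT := hO.isTree
  have hd := dist_eq_of_mem_support hT hp hw
  have h1 := hT.connected.pos_dist_of_ne hwc.symm
  have h2 := hT.connected.pos_dist_of_ne hwv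
  rcases exists_middle (f := f) hT hX ⟨v, hv.1⟩ with
    ⟨k, hk, c', x₁, x₂, h⟩ | ⟨x₁, x₂, hadj, hXp⟩ | ⟨a, b, x₁, x₂, h⟩
  · rw [h.subtreeCenter_eq hT] at hc
    obtain rfl : c = c' := hc
    have h3 := h.dist_le hT hv.1
    -- An internal node needs distance at least two between `v` and the center.
    obtain rfl : k = 2 := by omega
    exact hO.notMem_range_and_encard_eq_two hG hX hv h (by omega) (by omega)
  · exfalso
    have hadj' := SimpleGraph.dist_eq_one_iff_adj.2 hadj
    have hle : T.dist c (f v) ≤ 1 := by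
      have hvX := hv.1
      rw [hXp, subtreeCenter_image_pair hT hadj] at hc
      rw [hXp] at hvX
      rcases hc with rfl | rfl <;> rcases hvX with rfl | rfl <;>
        simp [hadj', dist_swap T _ (f v)]
    omega
  · exfalso
    obtain ⟨H, hH⟩ := hv.exists_isSide hT f hX
    have main : ∀ {a b : W} {x₁ x₂ : V}, HasMiddleEdge T f X a b x₁ x₂ → T.dist a (f v) = 1 →
        T.dist b (f v) = 2 → False := by
      intro a b x₁ x₂ h ha hb
      rw [h.subtreeCenter_eq hT] at hc hpc
      rcases hc with rfl | rfl
      · omega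
      · have hab := SimpleGraph.dist_eq_one_iff_adj.2 h.adj.symm
        -- From the farther center node, the path would meet the center again at the nearer one.
        have := hpc a (mem_support_of_dist_eq hT hp (by omega)) (by simp)
        exact h.adj.ne this
    rcases h.dist_eq_one_or_dist_eq_one hO hX hv.1 hH with h' | h'
    · exact main h h'.1 h'.2
    · exact main h.symm h'.2 h'.1

/-- The hull of a maximal clique `K` is `K` itself. If all of it were within three of `v`, its side
could be pushed one step away from `v`. -/
lemma IsOptimal.diam_eq (hO : IsOptimal r T f) (hG : G.Connected) {K : Set V}
    (hK : Maximal G.IsClique K) {v : V} (hv : IsFree G K v) :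
    (subtree T (f '' K)).ediam = 4 := by
  have hT := hO.isTree
  have hKI := mem_cliqueIntersections_of_maximal hK
  obtain ⟨u, hu, huv⟩ := exists_ne_of_isFree hG hv
  obtain ⟨H, hH⟩ := hv.exists_isSide hT f hKI
  have hle : ∀ x ∈ K, ∀ y ∈ K, T.dist (f x) (f y) ≤ 4 := fun x hx y hy =>
    dist_le_of_mem_cliqueHull f hx (subset_cliqueHull hKI hy)
  obtain ⟨y, hy, hvy⟩ : ∃ y ∈ K, T.dist (f v) (f y) = 4 := by
    by_contra! hne
    have := hO.dist_eq_of_isSide hH (f v) le_rfl (fun y hy => by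
      rw [cliqueHull_eq_of_maximal hK] at hy
      have h1 := hne y hy
      have h2 := hle v hv.1 y hy
      omega) (by simp) v hH.notMem u (hH.mem_of_mem_cliqueHull u (subset_cliqueHull hKI hu) huv)
    rw [T.dist_self] at this
    omega
  refine ediam_subtree_eq hT (ℓ := 4) ?_ (Set.mem_image_of_mem f hv.1)
    (Set.mem_image_of_mem f hy) hvy
  rintro _ ⟨x, hx, rfl⟩ _ ⟨y, hy, rfl⟩
  exact hle x hx y hy

end WellStructured

end SteinerPower

theorem theorem4p2 {V : Type u} [Finite V] [Nontrivial V] (G : SimpleGraph V) (hG : G.Connected)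
    (h : SteinerPower.IsSteinerPower 4 G) :
    ∃ (W : Type u) (_ : Finite W) (T : SimpleGraph W) (f : G ↪g SteinerPower.power T 4),
      T.IsTree ∧ SteinerPower.WellStructured G T f := by
  have := Fintype.ofFinite V
  obtain ⟨r⟩ := hG.nonempty
  obtain ⟨W, hW, T, f, hO⟩ := SteinerPower.exists_isOptimal hG h r
  exact ⟨W, hW, T, f, hO.isTree,
    { leaf := fun X hX _ v hv => hO.leaf hG hX hv
      grouped := fun X hX hne => hO.grouped hX hne
      internal := fun X hX _ v hv c hc p hp hpc w hw hwc hwv =>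
        hO.internal hG hX hv hc hp hpc hw hwc hwv
      diam_eq := fun K hK ⟨v, hv⟩ => hO.diam_eq hG hK hv }⟩
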